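/- Let $\Omega\subset\mathbb R^2$ be a bounded polygonal domain (open, connected, nonempty, without slits, i.e. $\operatorname{int}\overline\Omega=\Omega$, with boundary a finite union of segments), let $\Gamma_D\subset\partial\Omega$ be measurable with positive length, $\Gamma_N=\partial\Omega\setminus\Gamma_D$, let $\mathbf D\in\mathbb R^{3\times 3}$ be symmetric positive definite, and let $\mathbf b:\Omega\to\mathbb R^2$, $\mathbf t:\Gamma_N\to\mathbb R^2$ be integrable. Put $$f(\mathbf v)=\int_\Omega \mathbf b\cdot\mathbf v\,d\Omega+\int_{\Gamma_N}\mathbf t\cdot\mathbf v\,d\Gamma,\qquad \boldsymbol\epsilon[\mathbf u]=(\partial_x u_1,\ \partial_y u_2,\ \partial_y u_1+\partial_x u_2)^T .$$ Let $\mathcal T_h$ be a conforming subdivision of $\Omega$ either into nondegenerate triangles or into strictly convex quadrilaterals, where the nodes $\mathbf x_{T,1},\mathbf x_{T,2},\dots$ of each element $T$ are numbered counterclockwise, indices are cyclic, and the $i$-th edge of $T$ joins $\mathbf x_{T,i}$ and $\mathbf x_{T,i+1}$. (a) Triangles. Let $V_h$ be the space of continuous $\mathbf u:\overline\Omega\to\mathbb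 R^2$ that are affine on each $T\in\mathcal T_h$ and vanish almost everywhere on $\Gamma_D$. For a piecewise constant strain field $\boldsymbol\epsilon$, let $$\hat{\boldsymbol\epsilon}^{(i)}=\frac{1}{|T|+|T_i|}\Big(\int_T\boldsymbol\epsilon\,d\Omega+\int_{T_i}\boldsymbol\epsilon\,d\Omega\Big),$$ where $T_i$ is the element sharing the $i$-th edge of $T$, and $T_i=T$ if there is none. Let $S_h\boldsymbol\epsilon$ be the field that is affine on each $T$ and takes the value $\frac12(\hat{\boldsymbol\epsilon}^{(i-1)}+\hat{\boldsymbol\epsilon}^{(i)})$ at the Gaussian point with barycentric coordinate $\frac23$ at $\mathbf x_{T,i}$ and $\frac16$ at the other two nodes, $i=1,2,3$. (b) Quadrilaterals. Let $\mathbf x_{T,0}=\frac14\sum_{i=1}^4\mathbf x_{T,i}$ be the center point of $T$ and $\widehat T_i$ the triangle with vertices $\mathbf x_{T,i},\mathbf x_{T,i+1},\mathbf x_{T,0}$. Let $V_h$ be the space of continuous $\mathbf u:\overline\Omega\to\mathbb R^2$ that are affine on each subtriangle $\widehat T_i$ of each $T\in\mathcal T_h$, satisfy $\mathbf u(\mathbf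 x_{T,0})=\frac14\sum_{i=1}^4\mathbf u(\mathbf x_{T,i})$ for all $T$, and vanish almost everywhere on $\Gamma_D$. For a strain field $\boldsymbol\epsilon$ that is constant on each subtriangle, let $$\hat{\boldsymbol\epsilon}^{(i)}=\frac{1}{|\widehat T_i|+|\widehat T_i^*|}\Big(\int_{\widehat T_i}\boldsymbol\epsilon\,d\Omega+\int_{\widehat T_i^*}\boldsymbol\epsilon\,d\Omega\Big),$$ where $\widehat T_i^*$ is the subtriangle of the adjacent element that shares the $i$-th edge of $T$, and $\widehat T_i^*=\widehat T_i$ if there is none. Let $S_h\boldsymbol\epsilon$ be the field that on each $T$ is bilinear in the natural coordinates $(r,s)\in[-1,1]^2$ of $T$ (those of the bilinear map of the square onto $T$ that maps nodes to nodes) and takes the value $$\frac{|\widehat T_{i-1}|\,\hat{\boldsymbol\epsilon}^{(i-1)}+|\widehat T_i|\,\hat{\boldsymbol\epsilon}^{(i)}}{|\widehat T_{i-1}|+|\widehat T_i|}$$ at the $2\times2$ Gaussian point $(r_i,s_i)/\sqrt3$, where $(r_i,s_i)\in\{\pm1\}^2$ are the natural coordinates of $\mathbf x_{T,i}$, $i=1,\dots,4$.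 In both cases the strain-smoothed element (SSE) problem has a unique solution: there is exactly one $\bar{\mathbf u}_h\in V_h$ such that $$\int_\Omega \mathbf D\,S_h\boldsymbol\epsilon[\bar{\mathbf u}_h]\cdot S_h\boldsymbol\epsilon[\mathbf v]\,d\Omega=f(\mathbf v)\qquad\text{for all }\mathbf v\in V_h .$$ -/

import Mathlib

open MeasureTheory
open scoped Matrix

noncomputable section

namespace SSE

/-- The Euclidean plane. -/
abbrev Plane : Type := EuclideanSpace ℝ (Fin 2)

/-- Strains and stresses in Voigt notation, `(ε_xx, ε_yy, 2 ε_xy)`. -/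
abbrev Voigt : Type := Fin 3 → ℝ

/-- The planar cross product `a₀ b₁ - a₁ b₀`. -/
def cross (a b : Plane) : ℝ := a 0 * b 1 - a 1 * b 0

/-- A bounded polygonal domain: open, connected, nonempty, bounded, lying on one side of its
boundary (no slits), with a boundary that consists of finitely many line segments. -/
structure IsPolygonalDomain (Ω : Set Plane) : Prop where
  isOpen : IsOpen Ω
  isConnected : IsConnected Ω
  isBounded : Bornology.IsBounded Ω
  interior_closure : interior (closure Ω) = Ω
  frontier_segments : ∃ F : Finset (Plane × Plane), frontier Ω = ⋃ p ∈ F, segment ℝ p.1 p.2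

/-- A conforming subdivision of `Ω` into finitely many triangles (`n = 3`) or convex
quadrilaterals (`n = 4`). The nodes of the element `T` are `node T 0, …, node T (n - 1)`,
numbered counterclockwise, and indices of nodes are read modulo `n`.
Different elements have disjoint interiors, and they meet in the convex hull of
their common nodes, that is, in the empty set, a common node, or a common edge. -/
structure Mesh (n : ℕ) [NeZero n] (Ω : Set Plane) where
  numElements : ℕ
  node : Fin numElements → Fin n → Plane
  counterclockwise : ∀ T i,
    0 < cross (node T (i + 1) - node T i) (node T (i + 2) - node T (i + 1))
  cover : closure Ω = ⋃ T, convexHull ℝ (Set.range (node T))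
  disjoint_interior : ∀ T T', T ≠ T' →
    Disjoint (interior (convexHull ℝ (Set.range (node T))))
      (interior (convexHull ℝ (Set.range (node T'))))
  conforming : ∀ T T', T ≠ T' →
    convexHull ℝ (Set.range (node T)) ∩ convexHull ℝ (Set.range (node T')) =
      convexHull ℝ (Set.range (node T) ∩ Set.range (node T'))

/-- The function `u` coincides on `K` with an affine map, `u|_K ∈ (𝒫₁(K))²`. -/
def IsAffineOn (u : Plane → Plane) (K : Set Plane) : Prop :=
  ∃ g : Plane →ᵃ[ℝ] Plane, Set.EqOn u g K

/-- The strain `ε[u] = B u = (∂ₓ u₀, ∂_y u₁, ∂_y u₀ + ∂ₓ u₁)` at the point `x`. -/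
def strain (u : Plane → Plane) (x : Plane) : Voigt :=
  ![fderiv ℝ u x (EuclideanSpace.single 0 1) 0,
    fderiv ℝ u x (EuclideanSpace.single 1 1) 1,
    fderiv ℝ u x (EuclideanSpace.single 1 1) 0 + fderiv ℝ u x (EuclideanSpace.single 0 1) 1]

/-- The load functional `f(v) = ∫_Ω b · v + ∫_{Γ_N} t · v` with `Γ_N = ∂Ω \ Γ_D`; the second
integral is with respect to arc length. -/
def load (Ω ΓD : Set Plane) (b t : Plane → Plane) (v : Plane → Plane) : ℝ :=
  (∫ x in Ω, inner ℝ (b x) (v x)) +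
    ∫ x in frontier Ω \ ΓD, inner ℝ (t x) (v x) ∂(Measure.hausdorffMeasure 1)

/-- Continuous displacement fields on the closure of `Ω` that vanish on `Γ_D` (almost everywhere
with respect to arc length, as traces do). A field on the closure of `Ω` is represented by its
extension by zero to the plane, so that equality of fields is equality of functions. -/
def continuousFields (Ω ΓD : Set Plane) : Submodule ℝ (Plane → Plane) where
  carrier := {u | ContinuousOn u (closure Ω) ∧ (∀ x, x ∉ closure Ω → u x = 0) ∧
    ∀ᵐ x ∂((Measure.hausdorffMeasure 1 : Measure Plane).restrict ΓD), u x = 0}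
  zero_mem' := ⟨continuousOn_const, fun _ _ => rfl, Filter.Eventually.of_forall fun _ => rfl⟩
  add_mem' := by
    rintro u v ⟨hu, hu0, huD⟩ ⟨hv, hv0, hvD⟩
    refine ⟨hu.add hv, fun x hx => ?_, ?_⟩
    · simp [hu0 x hx, hv0 x hx]
    · filter_upwards [huD, hvD] with x hx hx'
      simp [hx, hx']
  smul_mem' := by
    rintro c u ⟨hu, hu0, huD⟩
    refine ⟨hu.const_smul c, fun x hx => ?_, ?_⟩
    · simp [hu0 x hx]
    · filter_upwards [huD] with x hx
      simp [hx]

theorem IsAffineOn.zero (K : Set Plane) : IsAffineOn 0 K :=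
  ⟨0, fun _ _ => rfl⟩

theorem IsAffineOn.add {u v : Plane → Plane} {K : Set Plane} (hu : IsAffineOn u K)
    (hv : IsAffineOn v K) : IsAffineOn (u + v) K := by
  obtain ⟨g, hg⟩ := hu
  obtain ⟨k, hk⟩ := hv
  exact ⟨g + k, fun x hx => by simp [hg hx, hk hx]⟩

theorem IsAffineOn.smul {u : Plane → Plane} {K : Set Plane} (c : ℝ) (hu : IsAffineOn u K) :
    IsAffineOn (c • u) K := by
  obtain ⟨g, hg⟩ := hu
  exact ⟨c • g, fun x hx => by simp [hg hx]⟩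

namespace Mesh

variable {n : ℕ} [NeZero n] {Ω : Set Plane}

/-- The (closed) element `T`. -/
def cell (𝒯 : Mesh n Ω) (T : Fin 𝒯.numElements) : Set Plane :=
  convexHull ℝ (Set.range (𝒯.node T))

/-- The `i`-th edge of `T` joins the nodes `i` and `i + 1`. `IsAdjacent T i T' j` says that the
`i`-th edge of `T` is the `j`-th edge of the different element `T'`. -/
def IsAdjacent (𝒯 : Mesh n Ω) (T : Fin 𝒯.numElements) (i : Fin n)
    (T' : Fin 𝒯.numElements) (j : Fin n) : Prop :=
  T' ≠ T ∧
    ({𝒯.node T' j, 𝒯.node T' (j + 1)} : Set Plane) = {𝒯.node T i, 𝒯.node T (i + 1)}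

open Classical in
/-- The element adjacent to `T` across its `i`-th edge, with the number of the common edge in
that element; `(T, i)` itself if there is no adjacent element across this edge. -/
def neighbor (𝒯 : Mesh n Ω) (T : Fin 𝒯.numElements) (i : Fin n) :
    Fin 𝒯.numElements × Fin n :=
  if h : ∃ q : Fin 𝒯.numElements × Fin n, 𝒯.IsAdjacent T i q.1 q.2 then h.choose else (T, i)

/-! ### The 3-node triangular element -/

/-- The displacement space `V_h` of the triangular element: continuous, vanishing on `Γ_D`,
and affine on each triangle. -/
def triSpace (𝒯 : Mesh 3 Ω) (ΓD : Set Plane) : Submodule ℝ (Plane → Plane) where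
  carrier := {u | u ∈ continuousFields Ω ΓD ∧ ∀ T, IsAffineOn u (𝒯.cell T)}
  zero_mem' := ⟨Submodule.zero_mem _, fun _ => IsAffineOn.zero _⟩
  add_mem' := fun hu hv => ⟨Submodule.add_mem _ hu.1 hv.1, fun T => (hu.2 T).add (hv.2 T)⟩
  smul_mem' := fun c _ hu => ⟨Submodule.smul_mem _ c hu.1, fun T => (hu.2 T).smul c⟩

/-- The intermediate smoothed strain
`(|T| + |T_i|)⁻¹ (∫_T ε + ∫_{T_i} ε)`, where `T_i` is the element adjacent to `T` across the
`i`-th edge, or `T` if there is none. -/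
def triIntermediate (𝒯 : Mesh 3 Ω) (ε : Plane → Voigt) (T : Fin 𝒯.numElements) (i : Fin 3) :
    Voigt :=
  (volume.real (𝒯.cell T) + volume.real (𝒯.cell (𝒯.neighbor T i).1))⁻¹ •
    ((∫ x in 𝒯.cell T, ε x) + ∫ x in 𝒯.cell (𝒯.neighbor T i).1, ε x)

/-- The value of the smoothed strain at the `i`-th Gaussian point of `T`, which is the one next
to the node `i`, at which the edges `i - 1` and `i` meet. -/
def triGaussValue (𝒯 : Mesh 3 Ω) (ε : Plane → Voigt) (T : Fin 𝒯.numElements) (i : Fin 3) :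
    Voigt :=
  (1 / 2 : ℝ) • (𝒯.triIntermediate ε T (i - 1) + 𝒯.triIntermediate ε T i)

/-- The `i`-th Gaussian point of the triangle `T`, with barycentric coordinates
`2/3` at the node `i` and `1/6` at the two other nodes. -/
def triGaussPoint (𝒯 : Mesh 3 Ω) (T : Fin 𝒯.numElements) (i : Fin 3) : Plane :=
  (2 / 3 : ℝ) • 𝒯.node T i + (1 / 6 : ℝ) • 𝒯.node T (i + 1) + (1 / 6 : ℝ) • 𝒯.node T (i + 2)

/-- The `i`-th barycentric coordinate of `x` with respect to the triangle `T`. -/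
def barycentric (𝒯 : Mesh 3 Ω) (T : Fin 𝒯.numElements) (i : Fin 3) (x : Plane) : ℝ :=
  cross (𝒯.node T (i + 1) - x) (𝒯.node T (i + 2) - x) /
    cross (𝒯.node T (i + 1) - 𝒯.node T i) (𝒯.node T (i + 2) - 𝒯.node T i)

/-- The affine function on `T` that takes the value `g i` at the `i`-th Gaussian point. -/
def triInterpolate (𝒯 : Mesh 3 Ω) (T : Fin 𝒯.numElements) (g : Fin 3 → Voigt) (x : Plane) :
    Voigt :=
  ∑ i, (2 * 𝒯.barycentric T i x - 1 / 3) • g i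

theorem triInterpolate_triGaussPoint (𝒯 : Mesh 3 Ω) (T : Fin 𝒯.numElements)
    (g : Fin 3 → Voigt) (j : Fin 3) :
    𝒯.triInterpolate T g (𝒯.triGaussPoint T j) = g j := by
  have key : ∀ i : Fin 3,
      2 * 𝒯.barycentric T i (𝒯.triGaussPoint T j) - 1 / 3 = if i = j then 1 else 0 := by
    intro i
    have hi : cross (𝒯.node T (i + 1) - 𝒯.node T i) (𝒯.node T (i + 2) - 𝒯.node T i) ≠ 0 := by
      have hi := 𝒯.counterclockwise T i
      simp only [cross, PiLp.sub_apply] at hi ⊢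
      intro h
      linarith
    rw [barycentric, sub_eq_iff_eq_add, ← mul_div_assoc, div_eq_iff hi]
    fin_cases i <;> fin_cases j <;> simp [cross, triGaussPoint] <;> ring
  simp only [triInterpolate, key]
  simp

/-- The smoothing operator `S_h` of the triangular element. The values on the
element boundaries, a null set, are immaterial and set to zero. -/
def triSmooth (𝒯 : Mesh 3 Ω) (ε : Plane → Voigt) (x : Plane) : Voigt :=
  ∑ T, (interior (𝒯.cell T)).indicator (𝒯.triInterpolate T (𝒯.triGaussValue ε T)) x

/-- The bilinear form `∫_Ω D S_h ε[u] : S_h ε[v]` of the strain-smoothed triangular element. -/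
def triForm (𝒯 : Mesh 3 Ω) (D : Matrix (Fin 3) (Fin 3) ℝ) (u v : Plane → Plane) : ℝ :=
  ∫ x in Ω, (D *ᵥ 𝒯.triSmooth (strain u) x) ⬝ᵥ 𝒯.triSmooth (strain v) x

/-! ### The 4-node quadrilateral element -/

/-- The nodes of the reference square `[-1, 1]²`, numbered counterclockwise. -/
def refNode : Fin 4 → ℝ × ℝ := ![(-1, -1), (1, -1), (1, 1), (-1, 1)]

/-- The bilinear map of the reference square onto the quadrilateral `T` that maps nodes to
nodes, `(r, s) ↦ ∑ i, (1 + r_i r) (1 + s_i s) / 4 • x_i`. -/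
def quadMap (𝒯 : Mesh 4 Ω) (T : Fin 𝒯.numElements) (p : ℝ × ℝ) : Plane :=
  ∑ i, ((1 + (refNode i).1 * p.1) * (1 + (refNode i).2 * p.2) / 4) • 𝒯.node T i

/-- The center point of `T`, with natural coordinates `r = s = 0`. -/
def center (𝒯 : Mesh 4 Ω) (T : Fin 𝒯.numElements) : Plane := 𝒯.quadMap T (0, 0)

/-- The subtriangle of `T` spanned by the `i`-th edge and the center point. -/
def subTriangle (𝒯 : Mesh 4 Ω) (T : Fin 𝒯.numElements) (i : Fin 4) : Set Plane :=
  convexHull ℝ {𝒯.node T i, 𝒯.node T (i + 1), 𝒯.center T}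

/-- The displacement space `V_h` of the quadrilateral element: continuous, vanishing on
`Γ_D`, affine on each subtriangle, and with the mean of the nodal values as value at the center
point of each element. -/
def quadSpace (𝒯 : Mesh 4 Ω) (ΓD : Set Plane) : Submodule ℝ (Plane → Plane) where
  carrier := {u | u ∈ continuousFields Ω ΓD ∧ (∀ T i, IsAffineOn u (𝒯.subTriangle T i)) ∧
    ∀ T, u (𝒯.center T) = (1 / 4 : ℝ) • ∑ i, u (𝒯.node T i)}
  zero_mem' := ⟨Submodule.zero_mem _, fun _ _ => IsAffineOn.zero _, fun _ => by simp⟩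
  add_mem' := fun hu hv => ⟨Submodule.add_mem _ hu.1 hv.1,
    fun T i => (hu.2.1 T i).add (hv.2.1 T i),
    fun T => by simp [hu.2.2 T, hv.2.2 T, Finset.sum_add_distrib]⟩
  smul_mem' := fun c _ hu => ⟨Submodule.smul_mem _ c hu.1, fun T i => (hu.2.1 T i).smul c,
    fun T => by simp [hu.2.2 T, ← Finset.smul_sum, smul_comm c]⟩

/-- The subtriangle that shares the `i`-th edge of `T` with the `i`-th subtriangle of `T` and
belongs to an adjacent element; the `i`-th subtriangle itself if there is no such element. -/
def neighborSubTriangle (𝒯 : Mesh 4 Ω) (T : Fin 𝒯.numElements) (i : Fin 4) : Set Plane :=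
  𝒯.subTriangle (𝒯.neighbor T i).1 (𝒯.neighbor T i).2

/-- The intermediate smoothed strain: the mean of `ε` over the `i`-th subtriangle of `T` and
its neighboring subtriangle. -/
def quadIntermediate (𝒯 : Mesh 4 Ω) (ε : Plane → Voigt) (T : Fin 𝒯.numElements) (i : Fin 4) :
    Voigt :=
  (volume.real (𝒯.subTriangle T i) + volume.real (𝒯.neighborSubTriangle T i))⁻¹ •
    ((∫ x in 𝒯.subTriangle T i, ε x) + ∫ x in 𝒯.neighborSubTriangle T i, ε x)

/-- The value of the smoothed strain at the `i`-th Gaussian point of `T`, which is the one next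
to the node `i`, at which the edges `i - 1` and `i` meet. -/
def quadGaussValue (𝒯 : Mesh 4 Ω) (ε : Plane → Voigt) (T : Fin 𝒯.numElements) (i : Fin 4) :
    Voigt :=
  (volume.real (𝒯.subTriangle T (i - 1)) + volume.real (𝒯.subTriangle T i))⁻¹ •
    (volume.real (𝒯.subTriangle T (i - 1)) • 𝒯.quadIntermediate ε T (i - 1) +
      volume.real (𝒯.subTriangle T i) • 𝒯.quadIntermediate ε T i)

/-- Natural coordinates `(r, s) ∈ [-1, 1]²` of a point of the quadrilateral `T`. -/
def naturalCoord (𝒯 : Mesh 4 Ω) (T : Fin 𝒯.numElements) (x : Plane) : ℝ × ℝ :=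
  Function.invFunOn (𝒯.quadMap T) (Set.Icc (-1 : ℝ) 1 ×ˢ Set.Icc (-1 : ℝ) 1) x

/-- The bilinear function of the natural coordinates with the value `g i` at the `i`-th point
`(r_i, s_i) / √3` of the `2 × 2` Gaussian quadrature. -/
def refInterpolate (g : Fin 4 → Voigt) (p : ℝ × ℝ) : Voigt :=
  ∑ i, ((1 + √3 * (refNode i).1 * p.1) * (1 + √3 * (refNode i).2 * p.2) / 4) • g i

theorem refInterpolate_gaussPoint (g : Fin 4 → Voigt) (j : Fin 4) :
    refInterpolate g ((refNode j).1 / √3, (refNode j).2 / √3) = g j := by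
  have h3 : √(3 : ℝ) ≠ 0 := by positivity
  have key : ∀ a b : ℝ, √3 * a * (b / √3) = a * b := fun a b => by field_simp
  have : ∀ i : Fin 4, (1 + (refNode i).1 * (refNode j).1) *
      (1 + (refNode i).2 * (refNode j).2) / 4 = if i = j then 1 else 0 := by
    intro i
    fin_cases i <;> fin_cases j <;> norm_num [refNode]
  simp [refInterpolate, key, this]

/-- The smoothing operator `S_h` of the quadrilateral element: bilinear interpolation, in the
natural coordinates of each element, of the values at the Gaussian points. The values on the
element boundaries, a null set, are immaterial and set to zero. -/
def quadSmooth (𝒯 : Mesh 4 Ω) (ε : Plane → Voigt) (x : Plane) : Voigt :=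
  ∑ T, (interior (𝒯.cell T)).indicator
    (fun y => refInterpolate (𝒯.quadGaussValue ε T) (𝒯.naturalCoord T y)) x

/-- The bilinear form `∫_Ω D S_h ε[u] : S_h ε[v]` of the strain-smoothed quadrilateral element. -/
def quadForm (𝒯 : Mesh 4 Ω) (D : Matrix (Fin 3) (Fin 3) ℝ) (u v : Plane → Plane) : ℝ :=
  ∫ x in Ω, (D *ᵥ 𝒯.quadSmooth (strain u) x) ⬝ᵥ 𝒯.quadSmooth (strain v) x

end Mesh

end SSE

end

noncomputable section

namespace SSE

/-! ### Plane geometry -/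

/-! Displacements are determined by their nodal values, so `V_h` is finite-dimensional, and
`existsUnique_variational` reduces both claims to one: a displacement whose smoothed strain vanishes
almost everywhere is zero. Continuity near the Gaussian points turns this into the vanishing of all
Gauss values.

Triangles: the Gauss values are half-sums of cyclically consecutive edge means, and since 3 is odd
all edge means vanish (`triIntermediate_eq_zero`). The elongation of a common edge depends only on
the displacements of its endpoints, hence is the same from both sides, and a vanishing weighted mean
forces it to be zero. Three elongations determine a strain (`eq_zero_of_elongation`), so each
element moves rigidly.

Quadrilaterals: 4 is even, so each component of the edge means could alternate in sign around an
element. This is excluded globally. The condition at the center makes the alternating sum of the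
strain integrals over the four subtriangles vanish (`alternating_sum_eq_zero`). Pairing strain
integrals with the signs of the means, and using that a mean is shared by the two sides of its edge,
gives a vanishing sum of positive multiples of absolute values (`average_eq_zero`). Then no edge is
elongated, and one strain-free subtriangle makes its element rigid (`eq_rigid_of_edge`). An edge on
the boundary supplies such a subtriangle, and opposite strain integrals across edges carry this to
all elements.

In both cases the rigid motions of adjacent elements agree at two nodes, so they coincide; since
elements are linked through edges (`edge_induction`), there is a single rigid motion, and it
vanishes at two points of `ΓD`, hence identically. -/

theorem Plane.ext {a b : Plane} (h0 : a 0 = b 0) (h1 : a 1 = b 1) : a = b := by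
  ext i
  fin_cases i
  · exact h0
  · exact h1

theorem exists_weights {n : ℕ} {x : Fin n → Plane} {y : Plane}
    (hy : y ∈ convexHull ℝ (Set.range x)) :
    ∃ w : Fin n → ℝ, (∀ i, 0 ≤ w i) ∧ ∑ i, w i = 1 ∧ ∑ i, w i • x i = y := by
  rw [convexHull_range_eq_exists_affineCombination] at hy
  obtain ⟨s, w, h0, h1, rfl⟩ := hy
  refine ⟨fun i => if i ∈ s then w i else 0, fun i => ?_, ?_, ?_⟩
  · dsimp only
    split_ifs with h
    exacts [h0 i h, le_rfl]
  · simpa using h1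
  · rw [Finset.affineCombination_eq_linear_combination _ _ _ h1]
    simp [ite_smul]

theorem sum_smul_mem_convexHull {n : ℕ} {x : Fin n → Plane} {w : Fin n → ℝ}
    (h0 : ∀ i, 0 ≤ w i) (h1 : ∑ i, w i = 1) :
    ∑ i, w i • x i ∈ convexHull ℝ (Set.range x) :=
  (convex_convexHull ℝ _).sum_mem (fun i _ => h0 i) h1
    fun i _ => subset_convexHull ℝ _ ⟨i, rfl⟩

theorem cross_sub_sum {n : ℕ} (x : Fin n → Plane) {w : Fin n → ℝ} (h1 : ∑ i, w i = 1)
    (a p : Plane) : cross a (∑ i, w i • x i - p) = ∑ i, w i * cross a (x i - p) := by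
  have : ∀ k : Fin 2, (∑ i, w i • x i) k = ∑ i, w i * x i k := by
    intro k; simp
  simp only [cross, PiLp.sub_apply, this]
  have hp : ∀ k, p k = ∑ i, w i * p k := fun k => by rw [← Finset.sum_mul, h1, one_mul]
  rw [hp 0, hp 1]
  simp only [← Finset.sum_sub_distrib, Finset.mul_sum]
  refine Finset.sum_congr rfl fun i _ => ?_
  rw [← hp 0, ← hp 1]
  ring

theorem cross_midpoint (a p q r : Plane) : cross a (midpoint ℝ p q - r) =
    (cross a (p - r) + cross a (q - r)) / 2 := by
  rw [midpoint_eq_smul_add]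
  simp [cross]
  ring

theorem continuous_cross {X : Type*} [TopologicalSpace X] {f g : X → Plane} (hf : Continuous f)
    (hg : Continuous g) : Continuous fun x => cross (f x) (g x) := by
  unfold cross
  fun_prop

/-- A triangle with vertices in counterclockwise order contains each point on the left of its
three sides. -/
theorem mem_convexHull_triangle {p q r y : Plane} (h : 0 < cross (q - p) (r - p))
    (h0 : 0 ≤ cross (q - p) (y - p)) (h1 : 0 ≤ cross (r - q) (y - q))
    (h2 : 0 ≤ cross (p - r) (y - r)) : y ∈ convexHull ℝ {p, q, r} := by
  -- The barycentric coordinates of `y` are ratios of signed areas.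
  have key : y = (cross (r - q) (y - q) / cross (q - p) (r - p)) • p +
      (cross (p - r) (y - r) / cross (q - p) (r - p)) • q +
      (cross (q - p) (y - p) / cross (q - p) (r - p)) • r := by
    have hne := h.ne'
    apply Plane.ext <;> simp only [PiLp.add_apply, PiLp.smul_apply, smul_eq_mul] <;>
      field_simp <;> simp only [cross, PiLp.sub_apply] <;> ring
  have hs : cross (r - q) (y - q) / cross (q - p) (r - p) +
      cross (p - r) (y - r) / cross (q - p) (r - p) +
      cross (q - p) (y - p) / cross (q - p) (r - p) = 1 := by
    rw [← add_div, ← add_div, div_eq_one_iff_eq h.ne']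
    simp only [cross, PiLp.sub_apply]
    ring
  have hp : p ∈ convexHull ℝ ({p, q, r} : Set Plane) := subset_convexHull ℝ _ (by simp)
  have hq : q ∈ convexHull ℝ ({p, q, r} : Set Plane) := subset_convexHull ℝ _ (by simp)
  have hr : r ∈ convexHull ℝ ({p, q, r} : Set Plane) := subset_convexHull ℝ _ (by simp)
  have := (convex_convexHull ℝ ({p, q, r} : Set Plane)).sum_mem (t := Finset.univ)
    (w := ![cross (r - q) (y - q) / cross (q - p) (r - p),
      cross (p - r) (y - r) / cross (q - p) (r - p),
      cross (q - p) (y - p) / cross (q - p) (r - p)]) (z := ![p, q, r])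
    (by
      intro i _
      fin_cases i
      exacts [div_nonneg h1 h.le, div_nonneg h2 h.le, div_nonneg h0 h.le])
    (by simpa [Fin.sum_univ_three] using hs)
    (by
      intro i _
      fin_cases i
      exacts [hp, hq, hr])
  rw [key]
  simpa [Fin.sum_univ_three] using this

/-- The points `x 0, …, x (n - 1)` are the vertices of a strictly convex polygon in
counterclockwise order. -/
structure IsConvexPolygon {n : ℕ} [NeZero n] (x : Fin n → Plane) : Prop where
  left : ∀ i k, k ≠ i → k ≠ i + 1 → 0 < cross (x (i + 1) - x i) (x k - x i)
  hull : ∀ y, (∀ i, 0 ≤ cross (x (i + 1) - x i) (y - x i)) → y ∈ convexHull ℝ (Set.range x)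
  -- Together the last two fields say that `n ≥ 3`.
  add_one_ne : ∀ i : Fin n, i + 1 ≠ i
  add_two_ne : ∀ i : Fin n, i + 1 + 1 ≠ i

theorem isConvexPolygon_three {x : Fin 3 → Plane}
    (h : ∀ i, 0 < cross (x (i + 1) - x i) (x (i + 2) - x (i + 1))) : IsConvexPolygon x where
  left i k := by
    have h0 := h i
    simp only [cross, PiLp.sub_apply] at *
    fin_cases i <;> fin_cases k <;> simp at h0 ⊢ <;> linarith
  hull y hy := by
    have := mem_convexHull_triangle (p := x 0) (q := x 1) (r := x 2) (y := y)
      (by have := h 0; simp only [cross, PiLp.sub_apply] at *; simp at this; linarith)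
      (hy 0) (hy 1) (hy 2)
    refine convexHull_mono ?_ this
    rintro _ (rfl | rfl | rfl) <;> exact ⟨_, rfl⟩
  add_one_ne := by decide
  add_two_ne := by decide

/-- With at most four vertices, every vertex off an edge is next to one of its endpoints, so the two
turns at the endpoints decide the side on which it lies. For the hull, the diagonal from `x 0` to `x
2` cuts the polygon into two triangles. -/
theorem isConvexPolygon_four {x : Fin 4 → Plane}
    (h : ∀ i, 0 < cross (x (i + 1) - x i) (x (i + 2) - x (i + 1))) : IsConvexPolygon x where
  left i k := by
    have h0 := h i
    have h1 := h (i + 3)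
    simp only [cross, PiLp.sub_apply] at *
    fin_cases i <;> fin_cases k <;> simp at h0 h1 ⊢ <;> linarith
  hull y hy := by
    have H0 := h 0
    have H2 := h 2
    simp only [cross, PiLp.sub_apply] at H0 H2
    simp only [Fin.isValue, zero_add, Fin.reduceAdd] at H0 H2
    rcases le_total 0 (cross (x 2 - x 0) (y - x 0)) with hd | hd
    · refine convexHull_mono ?_ (mem_convexHull_triangle (p := x 0) (q := x 2) (r := x 3)
        (y := y) ?_ hd (hy 2) (hy 3))
      · rintro _ (rfl | rfl | rfl) <;> exact ⟨_, rfl⟩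
      · simp only [cross, PiLp.sub_apply]
        linarith
    · refine convexHull_mono ?_ (mem_convexHull_triangle (p := x 0) (q := x 1) (r := x 2)
        (y := y) ?_ (hy 0) (hy 1) ?_)
      · rintro _ (rfl | rfl | rfl) <;> exact ⟨_, rfl⟩
      · simp only [cross, PiLp.sub_apply]
        linarith
      · simp only [cross, PiLp.sub_apply] at *
        linarith
  add_one_ne := by decide
  add_two_ne := by decide

/-! ### Strictly convex polygons: edges, vertices and interior points. -/

namespace IsConvexPolygon

variable {n : ℕ} [NeZero n] {x : Fin n → Plane}

theorem left_nonneg (hx : IsConvexPolygon x) (i k : Fin n) :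
    0 ≤ cross (x (i + 1) - x i) (x k - x i) := by
  by_cases h : k = i
  · simp [h, cross]
  by_cases h' : k = i + 1
  · subst h'
    apply le_of_eq
    simp only [cross]
    ring
  exact (hx.left i k h h').le

theorem injective (hx : IsConvexPolygon x) : Function.Injective x := by
  intro a b hab
  by_contra hne
  -- `left` says nothing about the endpoints of an edge, so for consecutive vertices the next edge
  -- is used.
  by_cases h : b = a + 1
  · subst h
    have := hx.left (a + 1) a hne (hx.add_two_ne a).symm
    rw [hab] at this
    simp [cross] at this
  · have := hx.left a b (Ne.symm hne) h
    rw [hab] at this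
    simp [cross] at this

theorem cross_nonneg (hx : IsConvexPolygon x) {y : Plane} (hy : y ∈ convexHull ℝ (Set.range x))
    (i : Fin n) :
    0 ≤ cross (x (i + 1) - x i) (y - x i) := by
  obtain ⟨w, h0, h1, rfl⟩ := exists_weights hy
  rw [cross_sub_sum x h1]
  exact Finset.sum_nonneg fun k _ => mul_nonneg (h0 k) (hx.left_nonneg i k)

theorem mem_interior (hx : IsConvexPolygon x) {y : Plane} (hy : ∀ i, 0 < cross (x (i + 1) - x i)
    (y - x i)) :
    y ∈ interior (convexHull ℝ (Set.range x)) := by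
  rw [_root_.mem_interior]
  refine ⟨{y | ∀ i, 0 < cross (x (i + 1) - x i) (y - x i)}, fun z hz => hx.hull z fun i =>
    (hz i).le, ?_, hy⟩
  simp only [Set.ofPred_forall]
  exact isOpen_iInter_of_finite fun i => isOpen_lt continuous_const
    (continuous_cross continuous_const (by fun_prop))

/-- For each edge, one of any two distinct vertices that are not its endpoints in some order is
strictly on its left. -/
theorem left_or_left (hx : IsConvexPolygon x) (i : Fin n) {a b : Fin n} (hab : a ≠ b)
    (h : ¬(a = i ∧ b = i + 1)) (h' : ¬(b = i ∧ a = i + 1)) :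
    0 < cross (x (i + 1) - x i) (x a - x i) ∨ 0 < cross (x (i + 1) - x i) (x b - x i) := by
  by_cases ha : a = i
  · refine Or.inr (hx.left i b ?_ ?_)
    · rintro rfl; exact hab ha
    · intro hb; exact h ⟨ha, hb⟩
  by_cases ha' : a = i + 1
  · refine Or.inr (hx.left i b ?_ ?_)
    · intro hb; exact h' ⟨hb, ha'⟩
    · rintro rfl; exact hab ha'
  exact Or.inl (hx.left i a ha ha')

/-- A point of the polygon on the line through an edge lies on this edge. -/
theorem mem_segment_of_cross_eq_zero (hx : IsConvexPolygon x) {y : Plane}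
    (hy : y ∈ convexHull ℝ (Set.range x)) {i : Fin n}
    (hi : cross (x (i + 1) - x i) (y - x i) = 0) : y ∈ segment ℝ (x i) (x (i + 1)) := by
  obtain ⟨w, h0, h1, rfl⟩ := exists_weights hy
  rw [cross_sub_sum x h1, Finset.sum_eq_zero_iff_of_nonneg fun k _ =>
    mul_nonneg (h0 k) (hx.left_nonneg i k)] at hi
  -- A vanishing sum of nonnegative terms: only the two endpoints of the edge can carry weight.
  have hw : ∀ j, j ≠ i → j ≠ i + 1 → w j = 0 := fun j hj hj' =>
    (mul_eq_zero.1 (hi j (Finset.mem_univ _))).resolve_right (hx.left i j hj hj').ne'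
  have hsum : ∀ {M : Type} [AddCommMonoid M] (f : Fin n → M), (∀ j, w j = 0 → f j = 0) →
      ∑ j, f j = f i + f (i + 1) := by
    intro M _ f hf
    rw [← Finset.sum_pair (hx.add_one_ne i).symm]
    symm
    refine Finset.sum_subset (Finset.subset_univ _) fun j _ hj => ?_
    simp only [Finset.mem_insert, Finset.mem_singleton, not_or] at hj
    exact hf j (hw j hj.1 hj.2)
  exact ⟨w i, w (i + 1), h0 _, h0 _, by rw [← hsum w fun _ h => h, h1],
    (hsum (fun j => w j • x j) fun j h => by simp [h]).symm⟩

/-- A point of the polygon on the line through the edge `i` that is not a vertex is strictly on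
the left of all other edges. -/
theorem pos_of_cross_eq_zero (hx : IsConvexPolygon x) {y : Plane}
    (hy : y ∈ convexHull ℝ (Set.range x))
    (hyx : y ∉ Set.range x) {i : Fin n} (hi : cross (x (i + 1) - x i) (y - x i) = 0)
    {k : Fin n} (hk : k ≠ i) : 0 < cross (x (k + 1) - x k) (y - x k) := by
  obtain ⟨a, b, ha, hb, hab, rfl⟩ := hx.mem_segment_of_cross_eq_zero hy hi
  have ha' : 0 < a := by
    refine lt_of_le_of_ne ha fun h => hyx ⟨i + 1, ?_⟩
    rw [← h, zero_add] at hab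
    simp [← h, hab]
  have hb' : 0 < b := by
    refine lt_of_le_of_ne hb fun h => hyx ⟨i, ?_⟩
    rw [← h, add_zero] at hab
    simp [← h, hab]
  have hcomb : cross (x (k + 1) - x k) (a • x i + b • x (i + 1) - x k) =
      a * cross (x (k + 1) - x k) (x i - x k) +
        b * cross (x (k + 1) - x k) (x (i + 1) - x k) := by
    obtain rfl : a = 1 - b := by linarith
    simp [cross]
    ring
  rw [hcomb]
  have h1 := hx.left_nonneg k i
  have h2 := hx.left_nonneg k (i + 1)
  rcases hx.left_or_left k (hx.add_one_ne i).symm (fun h => hk h.1.symm) (fun h =>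
    hx.add_two_ne i (by rw [h.1, ← h.2])) with h | h <;> positivity

/-- The midpoint of a diagonal is an interior point. -/
theorem midpoint_mem_interior (hx : IsConvexPolygon x) {a b : Fin n} (hab : a ≠ b)
    (h : b ≠ a + 1) (h' : a ≠ b + 1) :
    midpoint ℝ (x a) (x b) ∈ interior (convexHull ℝ (Set.range x)) := by
  refine hx.mem_interior fun i => ?_
  rw [cross_midpoint]
  have ha := hx.left_nonneg i a
  have hb := hx.left_nonneg i b
  rcases hx.left_or_left i hab (fun H => h (by rw [H.1, H.2])) (fun H => h' (by rw [H.1, H.2]))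
    with H | H <;> linarith

end IsConvexPolygon

/-! ### Connectivity of punctured open sets -/

/-- `univBall` maps the plane without the origin, which is connected, onto the punctured ball. -/
theorem isPreconnected_punctured_ball (c : Plane) {r : ℝ} (hr : 0 < r) :
    IsPreconnected (Metric.ball c r \ {c}) := by
  have h1 : 1 < Module.rank ℝ Plane := by
    apply Module.one_lt_rank_of_one_lt_finrank
    simp
  have h := (isConnected_compl_singleton_of_one_lt_rank h1 0).isPreconnected.image
    (OpenPartialHomeomorph.univBall c r)
    (OpenPartialHomeomorph.continuous_univBall c r).continuousOn
  convert h
  set e := OpenPartialHomeomorph.univBall c r (E := Plane)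
  have hs : e.source = Set.univ := OpenPartialHomeomorph.univBall_source c r
  have ht : e.target = Metric.ball c r := OpenPartialHomeomorph.univBall_target c hr
  have h0 : e 0 = c := OpenPartialHomeomorph.univBall_apply_zero c r
  have hinj : Function.Injective e := by
    rw [← Set.injOn_univ, ← hs]
    exact e.injOn
  rw [← ht, ← h0, ← e.image_source_eq_target, hs, Set.image_univ,
    Set.image_compl_eq_range_sdiff_image hinj,
    Set.image_singleton]

/-- In a separation of `U \ {x}`, a small punctured ball around `x` lies on one side. Adding the
whole ball to that side would separate `U`. -/
theorem IsPreconnected.diff_singleton {U : Set Plane} (hU : IsOpen U) (hc : IsPreconnected U)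
    (x : Plane) : IsPreconnected (U \ {x}) := by
  by_cases hx : x ∈ U
  swap
  · rwa [Set.sdiff_singleton_eq_self hx]
  obtain ⟨r, hr, hball⟩ := Metric.isOpen_iff.1 hU x hx
  have hP : Metric.ball x r \ {x} ⊆ U \ {x} := Set.sdiff_subset_sdiff_left hball
  have key : ∀ V W : Set Plane, IsOpen V → IsOpen W → U \ {x} ⊆ V ∪ W →
      U \ {x} ∩ (V ∩ W) = ∅ → Metric.ball x r \ {x} ⊆ V → U \ {x} ⊆ V := by
    intro V W hV hW hVW hd hPV y hy
    have hno : ∀ y, y ∈ U → y ≠ x → y ∈ V → y ∈ W → False := fun y hy hyx hyV hyW => by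
      have : y ∈ U \ {x} ∩ (V ∩ W) := ⟨⟨hy, hyx⟩, hyV, hyW⟩
      simp [hd] at this
    have hcov : U ⊆ (V ∪ Metric.ball x r) ∪ (W \ {x}) := by
      intro z hz
      by_cases hzx : z = x
      · exact Or.inl (Or.inr (by simpa [hzx] using hr))
      · rcases hVW ⟨hz, hzx⟩ with h | h
        · exact Or.inl (Or.inl h)
        · exact Or.inr ⟨h, hzx⟩
    have hemp : U ∩ ((V ∪ Metric.ball x r) ∩ (W \ {x})) = ∅ := by
      rw [Set.eq_empty_iff_forall_notMem]
      rintro z ⟨hz, h | h, hzW, hzx⟩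
      · exact hno z hz hzx h hzW
      · exact hno z hz hzx (hPV ⟨h, hzx⟩) hzW
    rcases isPreconnected_iff_subset_of_disjoint.1 hc _ _
      (hV.union Metric.isOpen_ball) (hW.sdiff isClosed_singleton) hcov hemp with h | h
    · rcases h hy.1 with h | h
      · exact h
      · exact hPV ⟨h, hy.2⟩
    · exact absurd rfl (h hx).2
  rw [isPreconnected_iff_subset_of_disjoint]
  intro V W hV hW hVW hd
  rcases isPreconnected_iff_subset_of_disjoint.1 (isPreconnected_punctured_ball x hr) V W hV hW
    (hP.trans hVW) (Set.subset_eq_empty (Set.inter_subset_inter_left _ hP) hd) with h | h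
  · exact Or.inl (key V W hV hW hVW hd h)
  · refine Or.inr (key W V hW hV (by rwa [Set.union_comm]) (by rwa [Set.inter_comm W V]) h)

theorem IsPreconnected.diff_finite {U s : Set Plane} (hU : IsOpen U) (hc : IsPreconnected U)
    (hs : s.Finite) : IsPreconnected (U \ s) := by
  induction s, hs using Set.Finite.induction_on with
  | empty => simpa using hc
  | @insert a s _ hs ih =>
    rw [Set.insert_eq, Set.union_comm, ← Set.sdiff_sdiff]
    exact IsPreconnected.diff_singleton (hU.sdiff hs.isClosed) ih a

/-! ### Geometry of meshes -/

namespace Mesh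

variable {n : ℕ} [NeZero n] {Ω : Set Plane} {𝒯 : Mesh n Ω}

theorem node_mem_cell (𝒯 : Mesh n Ω) (T : Fin 𝒯.numElements) (i : Fin n) :
    𝒯.node T i ∈ 𝒯.cell T :=
  subset_convexHull ℝ _ ⟨i, rfl⟩

theorem convex_cell (𝒯 : Mesh n Ω) (T : Fin 𝒯.numElements) : Convex ℝ (𝒯.cell T) :=
  convex_convexHull ℝ _

theorem isCompact_cell (𝒯 : Mesh n Ω) (T : Fin 𝒯.numElements) : IsCompact (𝒯.cell T) :=
  (Set.finite_range _).isCompact_convexHull ℝ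

theorem cell_subset_closure (𝒯 : Mesh n Ω) (T : Fin 𝒯.numElements) : 𝒯.cell T ⊆ closure Ω := by
  rw [𝒯.cover]
  exact Set.subset_iUnion (fun T => convexHull ℝ (Set.range (𝒯.node T))) T

theorem exists_mem_cell (𝒯 : Mesh n Ω) {x : Plane} (hx : x ∈ closure Ω) : ∃ T, x ∈ 𝒯.cell T := by
  rw [𝒯.cover] at hx
  exact Set.mem_iUnion.1 hx

theorem interior_cell_subset (𝒯 : Mesh n Ω) (hΩ : IsPolygonalDomain Ω)
    (T : Fin 𝒯.numElements) : interior (𝒯.cell T) ⊆ Ω := by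
  refine Set.Subset.trans ?_ hΩ.interior_closure.subset
  exact interior_mono (𝒯.cell_subset_closure T)

theorem eventually_cross_pos {a p y v : Plane} (h : 0 < cross a (y - p)) :
    ∀ᶠ δ : ℝ in nhdsWithin 0 (Set.Ioi 0), 0 < cross a (y + δ • v - p) := by
  apply eventually_nhdsWithin_of_eventually_nhds
  refine (continuous_cross (f := fun _ : ℝ => a) (g := fun δ : ℝ => y + δ • v - p)
    continuous_const (by fun_prop)).continuousAt.eventually (lt_mem_nhds ?_)
  simpa using h

/-- Just on the left of the midpoint of an edge are interior points of the polygon. -/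
theorem _root_.SSE.IsConvexPolygon.eventually_mem_interior {x : Fin n → Plane}
    (hx : IsConvexPolygon x) (i : Fin n) :
    ∀ᶠ δ : ℝ in nhdsWithin 0 (Set.Ioi 0), midpoint ℝ (x i) (x (i + 1)) +
      δ • !₂[-(x (i + 1) 1 - x i 1), x (i + 1) 0 - x i 0] ∈
        interior (convexHull ℝ (Set.range x)) := by
  have : ∀ k, ∀ᶠ δ : ℝ in nhdsWithin 0 (Set.Ioi 0), 0 < cross (x (k + 1) - x k)
      (midpoint ℝ (x i) (x (i + 1)) +
        δ • !₂[-(x (i + 1) 1 - x i 1), x (i + 1) 0 - x i 0] - x k) := by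
    intro k
    -- The shift is along the left normal of the edge `i`, so the cross product with this edge
    -- becomes `δ` times its squared length. With respect to the other edges the midpoint is already
    -- strictly on the left, and small shifts preserve this.
    by_cases hk : k = i
    · subst hk
      filter_upwards [self_mem_nhdsWithin] with δ (hδ : 0 < δ)
      have hm : cross (x (k + 1) - x k) (midpoint ℝ (x k) (x (k + 1)) - x k) = 0 := by
        rw [cross_midpoint]
        simp only [cross]
        simp
        ring
      have hd : x (k + 1) ≠ x k := fun h => hx.add_one_ne k (hx.injective h)
      have hpos : 0 < (x (k + 1) 0 - x k 0) ^ 2 + (x (k + 1) 1 - x k 1) ^ 2 := by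
        by_contra hle
        refine hd (Plane.ext ?_ ?_) <;> nlinarith [sq_nonneg (x (k + 1) 0 - x k 0),
          sq_nonneg (x (k + 1) 1 - x k 1)]
      have : cross (x (k + 1) - x k) (midpoint ℝ (x k) (x (k + 1)) +
          δ • !₂[-(x (k + 1) 1 - x k 1), x (k + 1) 0 - x k 0] - x k) =
          cross (x (k + 1) - x k) (midpoint ℝ (x k) (x (k + 1)) - x k) +
          δ * ((x (k + 1) 0 - x k 0) ^ 2 + (x (k + 1) 1 - x k 1) ^ 2) := by
        simp only [cross, PiLp.add_apply, PiLp.sub_apply, PiLp.smul_apply, smul_eq_mul,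
          Matrix.cons_val_zero, Matrix.cons_val_one]
        ring
      rw [this, hm, zero_add]
      positivity
    · refine eventually_cross_pos ?_
      rw [cross_midpoint]
      have h1 := hx.left_nonneg k i
      have h2 := hx.left_nonneg k (i + 1)
      rcases hx.left_or_left k (hx.add_one_ne i).symm (fun h => hk h.1.symm)
        (fun h => hx.add_two_ne i (by rw [h.1, ← h.2])) with h | h <;> linarith
  filter_upwards [Filter.eventually_all.2 this] with δ hδ
  exact hx.mem_interior hδ

theorem nonempty_interior_cell (h𝒯 : ∀ T, IsConvexPolygon (𝒯.node T))
    (T : Fin 𝒯.numElements) : (interior (𝒯.cell T)).Nonempty := by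
  obtain ⟨δ, hδ⟩ := ((h𝒯 T).eventually_mem_interior 0).exists
  exact ⟨_, hδ⟩

/-- A convex set with interior points lies in the closure of its interior, so an interior point of
`T` in `T'` would be approximated by interior points of `T'`. -/
theorem notMem_interior_cell (h𝒯 : ∀ T, IsConvexPolygon (𝒯.node T))
    {T T' : Fin 𝒯.numElements} (hne : T ≠ T') {y : Plane}
    (hy : y ∈ 𝒯.cell T') : y ∉ interior (𝒯.cell T) := by
  intro hy'
  have hcl : y ∈ closure (interior (𝒯.cell T')) := by
    rw [(𝒯.convex_cell T').closure_interior_eq_closure_of_nonempty_interior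
      (nonempty_interior_cell h𝒯 T')]
    exact subset_closure hy
  obtain ⟨z, hz, hz'⟩ := mem_closure_iff.1 hcl _ isOpen_interior hy'
  exact Set.disjoint_left.1 (𝒯.disjoint_interior T T' hne) hz hz'

/-- An oriented edge belongs to at most one element. -/
theorem eq_of_same_edge (h𝒯 : ∀ T, IsConvexPolygon (𝒯.node T))
    {T T' : Fin 𝒯.numElements} {i j : Fin n}
    (h0 : 𝒯.node T' j = 𝒯.node T i) (h1 : 𝒯.node T' (j + 1) = 𝒯.node T (i + 1)) : T = T' := by
  by_contra hne
  have h := (h𝒯 T).eventually_mem_interior i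
  have h' := (h𝒯 T').eventually_mem_interior j
  rw [h0, h1] at h'
  obtain ⟨δ, hδ, hδ'⟩ := (h.and h').exists
  exact Set.disjoint_left.1 (𝒯.disjoint_interior T T' hne) hδ hδ'

/-- Both elements are numbered counterclockwise. If they ran through the common edge in the same
direction, both would contain the points just on its left. -/
theorem IsAdjacent.node_eq (h𝒯 : ∀ T, IsConvexPolygon (𝒯.node T))
    {T T' : Fin 𝒯.numElements} {i j : Fin n}
    (h : 𝒯.IsAdjacent T i T' j) :
    𝒯.node T' j = 𝒯.node T (i + 1) ∧ 𝒯.node T' (j + 1) = 𝒯.node T i := by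
  rcases Set.pair_eq_pair_iff.1 h.2 with h' | h'
  · exact absurd (eq_of_same_edge h𝒯 h'.1 h'.2).symm h.1
  · exact h'

theorem IsAdjacent.symm {T T' : Fin 𝒯.numElements} {i j : Fin n}
    (h : 𝒯.IsAdjacent T i T' j) : 𝒯.IsAdjacent T' j T i :=
  ⟨h.1.symm, h.2.symm⟩

theorem IsAdjacent.unique (h𝒯 : ∀ T, IsConvexPolygon (𝒯.node T))
    {T T' T'' : Fin 𝒯.numElements} {i j k : Fin n}
    (h : 𝒯.IsAdjacent T i T' j) (h' : 𝒯.IsAdjacent T i T'' k) : T' = T'' ∧ j = k := by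
  obtain ⟨h0, h1⟩ := h.node_eq h𝒯
  obtain ⟨h0', h1'⟩ := h'.node_eq h𝒯
  obtain rfl := eq_of_same_edge h𝒯 (h0'.trans h0.symm) (h1'.trans h1.symm)
  exact ⟨rfl, (h𝒯 T').injective (h0.trans h0'.symm)⟩

theorem neighbor_eq (h𝒯 : ∀ T, IsConvexPolygon (𝒯.node T))
    {T T' : Fin 𝒯.numElements} {i j : Fin n}
    (h : 𝒯.IsAdjacent T i T' j) : 𝒯.neighbor T i = (T', j) := by
  have hex : ∃ q : Fin 𝒯.numElements × Fin n, 𝒯.IsAdjacent T i q.1 q.2 := ⟨(T', j), h⟩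
  rw [neighbor, dif_pos hex]
  obtain ⟨h1, h2⟩ := hex.choose_spec.unique h𝒯 h
  exact Prod.ext h1 h2

theorem neighbor_eq_self {T : Fin 𝒯.numElements} {i : Fin n}
    (h : ¬∃ q : Fin 𝒯.numElements × Fin n, 𝒯.IsAdjacent T i q.1 q.2) :
    𝒯.neighbor T i = (T, i) := by
  rw [neighbor, dif_neg h]

theorem neighbor_cases (𝒯 : Mesh n Ω) (T : Fin 𝒯.numElements) (i : Fin n) :
    𝒯.neighbor T i = (T, i) ∨ 𝒯.IsAdjacent T i (𝒯.neighbor T i).1 (𝒯.neighbor T i).2 := by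
  by_cases hex : ∃ q : Fin 𝒯.numElements × Fin n, 𝒯.IsAdjacent T i q.1 q.2
  · right
    rw [neighbor, dif_pos hex]
    exact hex.choose_spec
  · exact Or.inl (neighbor_eq_self hex)

/-- Makes `neighbor` an involution on pairs (element, edge), with boundary edges as fixed points;
the summation in `average_eq_zero` rests on it. -/
theorem neighbor_neighbor (h𝒯 : ∀ T, IsConvexPolygon (𝒯.node T))
    (T : Fin 𝒯.numElements) (i : Fin n) :
    𝒯.neighbor (𝒯.neighbor T i).1 (𝒯.neighbor T i).2 = (T, i) := by
  rcases 𝒯.neighbor_cases T i with h | h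
  · rw [h]
    exact h
  · exact neighbor_eq h𝒯 h.symm

/-- Two elements with two common nodes share an edge. -/
theorem exists_isAdjacent (h𝒯 : ∀ T, IsConvexPolygon (𝒯.node T))
    {T T' : Fin 𝒯.numElements} (hne : T ≠ T') {p q : Plane} (hpq : p ≠ q)
    (hp : p ∈ Set.range (𝒯.node T)) (hp' : p ∈ Set.range (𝒯.node T'))
    (hq : q ∈ Set.range (𝒯.node T)) (hq' : q ∈ Set.range (𝒯.node T')) :
    ∃ i j, 𝒯.IsAdjacent T i T' j := by
  have key : ∀ S S' : Fin 𝒯.numElements, S ≠ S' → p ∈ Set.range (𝒯.node S) →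
      p ∈ Set.range (𝒯.node S') → q ∈ Set.range (𝒯.node S) → q ∈ Set.range (𝒯.node S') →
      ∃ i, ({𝒯.node S i, 𝒯.node S (i + 1)} : Set Plane) = {p, q} := by
    rintro S S' hS ⟨a, rfl⟩ hp' ⟨b, rfl⟩ hq'
    by_contra! hno
    -- If the two nodes spanned a diagonal of `S`, their midpoint would be interior to `S`, yet it
    -- belongs to `S'`.
    refine notMem_interior_cell h𝒯 hS ?_ ((h𝒯 S).midpoint_mem_interior (a := a) (b := b) ?_ ?_ ?_)
    · exact (𝒯.convex_cell S').midpoint_mem (subset_convexHull ℝ _ hp')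
        (subset_convexHull ℝ _ hq')
    · rintro rfl
      exact hpq rfl
    · rintro rfl
      exact hno a rfl
    · rintro rfl
      exact hno b (Set.pair_comm _ _)
  obtain ⟨i, hi⟩ := key T T' hne hp hp' hq hq'
  obtain ⟨j, hj⟩ := key T' T hne.symm hp' hp hq' hq
  exact ⟨i, j, hne.symm, hj.trans hi.symm⟩

/-- The elements of a mesh are connected through common edges. -/
theorem edge_induction (h𝒯 : ∀ T, IsConvexPolygon (𝒯.node T))
    (hΩ : IsPolygonalDomain Ω) (P : Fin 𝒯.numElements → Prop)
    (hP : ∀ T i T' j, 𝒯.IsAdjacent T i T' j → P T → P T') (hex : ∃ T, P T) : ∀ T, P T := by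
  intro T'
  by_contra hT'
  obtain ⟨T, hT⟩ := hex
  set N : Set Plane := ⋃ T, Set.range (𝒯.node T) with hN
  have hNfin : N.Finite := Set.finite_iUnion fun T => Set.finite_range _
  -- Without the nodes, contacts of elements at a single node disappear, so a cell with `P` and a
  -- cell without it have no common point left. The two unions of cells would then disconnect `Ω \
  -- N`.
  have hpre : IsPreconnected (Ω \ N) :=
    IsPreconnected.diff_finite hΩ.isOpen hΩ.isConnected.isPreconnected hNfin
  have hclosed : ∀ s : Set (Fin 𝒯.numElements), IsClosed (⋃ T ∈ s, 𝒯.cell T) := fun s =>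
    (Set.toFinite s).isClosed_biUnion fun T _ => (𝒯.isCompact_cell T).isClosed
  have hdisj : ∀ S S', P S → ¬P S' → ∀ y ∈ 𝒯.cell S, y ∈ 𝒯.cell S' → y ∈ N := by
    intro S S' hS hS' y hy hy'
    have hne : S ≠ S' := by
      rintro rfl
      exact hS' hS
    have hmem : y ∈ convexHull ℝ (Set.range (𝒯.node S) ∩ Set.range (𝒯.node S')) := by
      rw [← 𝒯.conforming S S' hne]
      exact ⟨hy, hy'⟩
    by_cases hsub : (Set.range (𝒯.node S) ∩ Set.range (𝒯.node S')).Subsingleton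
    · rw [hsub.convex.convexHull_eq] at hmem
      exact Set.mem_iUnion.2 ⟨S, hmem.1⟩
    · rw [Set.not_subsingleton_iff] at hsub
      obtain ⟨p, hp, q, hq, hpq⟩ := hsub
      obtain ⟨i, j, hadj⟩ := exists_isAdjacent h𝒯 hne hpq hp.1 hp.2 hq.1 hq.2
      exact absurd (hP _ _ _ _ hadj hS) hS'
  have hpoint : ∀ S, ∃ y ∈ Ω \ N, y ∈ interior (𝒯.cell S) := by
    intro S
    have hinf : (interior (𝒯.cell S)).Infinite :=
      infinite_of_mem_nhds _ (isOpen_interior.mem_nhds (nonempty_interior_cell h𝒯 S).some_mem)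
    obtain ⟨y, hy, hyN⟩ := (hinf.sdiff hNfin).nonempty
    exact ⟨y, ⟨𝒯.interior_cell_subset hΩ S hy, hyN⟩, hy⟩
  have hcov : Ω \ N ⊆ (⋃ T ∈ {T | P T}, 𝒯.cell T) ∪ ⋃ T ∈ {T | ¬P T}, 𝒯.cell T := by
    intro y hy
    obtain ⟨S, hS⟩ := 𝒯.exists_mem_cell (subset_closure hy.1)
    by_cases hPS : P S
    · exact Or.inl (Set.mem_iUnion₂.2 ⟨S, hPS, hS⟩)
    · exact Or.inr (Set.mem_iUnion₂.2 ⟨S, hPS, hS⟩)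
  have hemp : Ω \ N ∩ ((⋃ T ∈ {T | P T}, 𝒯.cell T) ∩ ⋃ T ∈ {T | ¬P T}, 𝒯.cell T) = ∅ := by
    rw [Set.eq_empty_iff_forall_notMem]
    rintro y ⟨hy, hyA, hyB⟩
    obtain ⟨S, hS, hyS⟩ := Set.mem_iUnion₂.1 hyA
    obtain ⟨S', hS', hyS'⟩ := Set.mem_iUnion₂.1 hyB
    exact hy.2 (hdisj S S' hS hS' y hyS hyS')
  rcases isPreconnected_iff_subset_of_disjoint_closed.1 hpre _ _ (hclosed _) (hclosed _) hcov hemp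
    with h | h
  · obtain ⟨y, hy, hyT⟩ := hpoint T'
    obtain ⟨S, hS, hyS⟩ := Set.mem_iUnion₂.1 (h hy)
    exact hy.2 (hdisj S T' hS hT' y hyS (interior_subset hyT))
  · obtain ⟨y, hy, hyT⟩ := hpoint T
    obtain ⟨S, hS, hyS⟩ := Set.mem_iUnion₂.1 (h hy)
    exact hy.2 (hdisj T S hT hS y (interior_subset hyT) hyS)

/-- Some edge belongs to one element only. -/
theorem exists_boundary_edge (h𝒯 : ∀ T, IsConvexPolygon (𝒯.node T))
    (hΩ : IsPolygonalDomain Ω) (hinf : (frontier Ω).Infinite) :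
    ∃ T i, ¬∃ q : Fin 𝒯.numElements × Fin n, 𝒯.IsAdjacent T i q.1 q.2 := by
  have hNfin : (⋃ T, Set.range (𝒯.node T)).Finite := Set.finite_iUnion fun T => Set.finite_range _
  obtain ⟨y, hy, hyN⟩ := (hinf.sdiff hNfin).nonempty
  have hyN' : ∀ T, y ∉ Set.range (𝒯.node T) := fun T h => hyN (Set.mem_iUnion.2 ⟨T, h⟩)
  have hyΩ : y ∉ Ω := by
    rw [← hΩ.isOpen.interior_eq]
    exact hy.2
  obtain ⟨T, hT⟩ := 𝒯.exists_mem_cell hy.1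
  -- A frontier point is not interior to its element, so it lies on an edge. If this edge were
  -- shared, the two elements would cover a neighborhood of the point.
  have hex : ∃ i, cross (𝒯.node T (i + 1) - 𝒯.node T i) (y - 𝒯.node T i) = 0 := by
    by_contra! hno
    exact hyΩ (𝒯.interior_cell_subset hΩ T ((h𝒯 T).mem_interior fun i =>
      lt_of_le_of_ne ((h𝒯 T).cross_nonneg hT i) (hno i).symm))
  obtain ⟨i, hi⟩ := hex
  refine ⟨T, i, ?_⟩
  rintro ⟨⟨T', j⟩, hadj⟩
  obtain ⟨h0, h1⟩ := hadj.node_eq h𝒯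
  simp only at h0 h1
  have hflip : ∀ z, cross (𝒯.node T' (j + 1) - 𝒯.node T' j) (z - 𝒯.node T' j) =
      -cross (𝒯.node T (i + 1) - 𝒯.node T i) (z - 𝒯.node T i) := by
    intro z
    rw [h0, h1]
    simp only [cross, PiLp.sub_apply]
    ring
  have hT' : y ∈ 𝒯.cell T' := by
    have hmem := (h𝒯 T).mem_segment_of_cross_eq_zero hT hi
    rw [← convexHull_pair, ← hadj.2] at hmem
    refine convexHull_mono ?_ hmem
    rintro _ (rfl | rfl) <;> exact ⟨_, rfl⟩
  have hcont : ∀ (a p : Plane), 0 < cross a (y - p) → ∀ᶠ z in nhds y, 0 < cross a (z - p) :=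
    fun a p h => (continuous_cross (f := fun _ : Plane => a) (g := fun z : Plane => z - p)
      continuous_const (by fun_prop)).continuousAt.eventually (lt_mem_nhds h)
  have e1 : ∀ᶠ z in nhds y, ∀ k, k ≠ i →
      0 < cross (𝒯.node T (k + 1) - 𝒯.node T k) (z - 𝒯.node T k) := by
    refine Filter.eventually_all.2 fun k => ?_
    by_cases hk : k = i
    · simp [hk]
    · filter_upwards [hcont _ _ ((h𝒯 T).pos_of_cross_eq_zero hT (hyN' T) hi hk)] with z hz _
      exact hz
  have e2 : ∀ᶠ z in nhds y, ∀ k, k ≠ j →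
      0 < cross (𝒯.node T' (k + 1) - 𝒯.node T' k) (z - 𝒯.node T' k) := by
    refine Filter.eventually_all.2 fun k => ?_
    by_cases hk : k = j
    · simp [hk]
    · filter_upwards [hcont _ _ ((h𝒯 T').pos_of_cross_eq_zero hT' (hyN' T')
        (by rw [hflip, hi, neg_zero]) hk)] with z hz _
      exact hz
  refine hyΩ ?_
  -- The absence of slits enters here: a point with a neighborhood in the closure belongs to `Ω`.
  rw [← hΩ.interior_closure, mem_interior_iff_mem_nhds]
  filter_upwards [e1, e2] with z hz1 hz2
  -- Near `y` only the inequality of the common edge can fail, and it has opposite signs for the two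
  -- elements.
  rcases le_total 0 (cross (𝒯.node T (i + 1) - 𝒯.node T i) (z - 𝒯.node T i)) with h | h
  · refine 𝒯.cell_subset_closure T ((h𝒯 T).hull z fun k => ?_)
    by_cases hk : k = i
    · rwa [hk]
    · exact (hz1 k hk).le
  · refine 𝒯.cell_subset_closure T' ((h𝒯 T').hull z fun k => ?_)
    by_cases hk : k = j
    · rw [hk, hflip]
      linarith
    · exact (hz2 k hk).le

end Mesh

/-! ### Variational problems with a smoothed strain -/

theorem integrableOn_form {Ω : Set Plane} (hΩ : volume Ω < ⊤) (D : Matrix (Fin 3) (Fin 3) ℝ)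
    {a b : Plane → Voigt} (ha : Measurable a) (hb : Measurable b)
    (ha' : ∃ C, ∀ x, ‖a x‖ ≤ C) (hb' : ∃ C, ∀ x, ‖b x‖ ≤ C) :
    IntegrableOn (fun x => (D *ᵥ a x) ⬝ᵥ b x) Ω := by
  obtain ⟨A, hA⟩ := ha'
  obtain ⟨B, hB⟩ := hb'
  have : IsFiniteMeasure (volume.restrict Ω) := ⟨by simpa using hΩ⟩
  have heq : (fun x => (D *ᵥ a x) ⬝ᵥ b x) = fun x => ∑ i, ∑ j, D i j * (a x j * b x i) := by
    funext x
    simp [dotProduct, Matrix.mulVec, Finset.sum_mul, mul_assoc]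
  rw [heq]
  refine integrable_finsetSum _ fun i _ => integrable_finsetSum _ fun j _ =>
    Integrable.const_mul (Integrable.of_bound (C := A * B) ?_ (Filter.Eventually.of_forall ?_)) _
  · exact (((measurable_pi_apply j).comp ha).mul
      ((measurable_pi_apply i).comp hb)).aestronglyMeasurable
  · intro x
    rw [norm_mul]
    exact mul_le_mul ((norm_le_pi_norm _ _).trans (hA x)) ((norm_le_pi_norm _ _).trans (hB x))
      (norm_nonneg _) ((norm_nonneg _).trans (hA x))

/-- The variational problem of a bounded linear smoothing operator that vanishes only at zero
has a unique solution in each finite-dimensional space. -/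
theorem existsUnique_variational {Ω : Set Plane} (hΩ : volume Ω < ⊤)
    {D : Matrix (Fin 3) (Fin 3) ℝ} (hD : D.PosDef) (V : Submodule ℝ (Plane → Plane))
    [FiniteDimensional ℝ V] (S : (Plane → Plane) → Plane → Voigt)
    (hadd : ∀ u ∈ V, ∀ v ∈ V, S (u + v) = S u + S v)
    (hsmul : ∀ (c : ℝ), ∀ u ∈ V, S (c • u) = c • S u)
    (hmeas : ∀ u ∈ V, Measurable (S u)) (hbdd : ∀ u ∈ V, ∃ C, ∀ x, ‖S u x‖ ≤ C)
    (hinj : ∀ u ∈ V, S u =ᵐ[volume.restrict Ω] 0 → u = 0)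
    (f : (Plane → Plane) → ℝ) (fadd : ∀ u ∈ V, ∀ v ∈ V, f (u + v) = f u + f v)
    (fsmul : ∀ (c : ℝ), ∀ u ∈ V, f (c • u) = c * f u) :
    ∃! u, u ∈ V ∧ ∀ v ∈ V, ∫ x in Ω, (D *ᵥ S u x) ⬝ᵥ S v x = f v := by
  have hint : ∀ u v : V, IntegrableOn (fun x => (D *ᵥ S u x) ⬝ᵥ S v x) Ω := fun u v =>
    integrableOn_form hΩ D (hmeas u u.2) (hmeas v v.2) (hbdd u u.2) (hbdd v v.2)
  let B : V →ₗ[ℝ] Module.Dual ℝ V := LinearMap.mk₂ ℝ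
    (fun u v : V => ∫ x in Ω, (D *ᵥ S u x) ⬝ᵥ S v x)
    (by
      intro u u' v
      rw [← integral_add (hint u v) (hint u' v)]
      simp [hadd u u.2 u' u'.2, Matrix.mulVec_add, add_dotProduct])
    (by
      intro c u v
      rw [smul_eq_mul, ← integral_const_mul]
      simp [hsmul c u u.2, Matrix.mulVec_smul])
    (by
      intro u v v'
      rw [← integral_add (hint u v) (hint u v')]
      simp [hadd v v.2 v' v'.2, dotProduct_add])
    (by
      intro c u v
      rw [smul_eq_mul, ← integral_const_mul]
      simp [hsmul c v v.2])
  have hBinj : Function.Injective B := by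
    rw [injective_iff_map_eq_zero]
    intro u hu
    have h0 : ∫ x in Ω, (D *ᵥ S u x) ⬝ᵥ S u x = 0 := by
      have : B u u = 0 := by rw [hu]; rfl
      exact this
    have hpos : ∀ w : Voigt, w ≠ 0 → 0 < (D *ᵥ w) ⬝ᵥ w := fun w hw => by
      simpa [dotProduct_comm] using hD.dotProduct_mulVec_pos hw
    have hnn : ∀ w : Voigt, 0 ≤ (D *ᵥ w) ⬝ᵥ w := fun w => by
      by_cases hw : w = 0
      · simp [hw]
      · exact (hpos w hw).le
    rw [integral_eq_zero_iff_of_nonneg (fun x => hnn _) (hint u u)] at h0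
    apply Subtype.ext
    refine hinj u u.2 ?_
    filter_upwards [h0] with x hx
    by_contra hne
    exact (hpos _ hne).ne' hx
  -- `V` and its dual have equal finite dimension, so injectivity already gives existence.
  have hBsurj : Function.Surjective B :=
    (LinearMap.injective_iff_surjective_of_finrank_eq_finrank
      Subspace.dual_finrank_eq.symm).1 hBinj
  let F : Module.Dual ℝ V :=
    { toFun := fun v => f v
      map_add' := fun u v => fadd u u.2 v v.2
      map_smul' := fun c u => fsmul c u u.2 }
  obtain ⟨u, hu⟩ := hBsurj F
  refine ⟨u, ⟨u.2, fun v hv => ?_⟩, ?_⟩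
  · exact LinearMap.congr_fun hu ⟨v, hv⟩
  · rintro u' ⟨hu'V, hu'⟩
    have : B ⟨u', hu'V⟩ = B u := by
      rw [hu]
      ext v
      exact hu' v v.2
    exact congrArg Subtype.val (hBinj this)

theorem integrableOn_inner {μ : Measure Plane} {K s : Set Plane} {b v : Plane → Plane}
    (hb : IntegrableOn b s μ) (hs : MeasurableSet s) (hK : IsCompact K) (hsK : s ⊆ K)
    (hv : ContinuousOn v K) : IntegrableOn (fun x => inner ℝ (b x) (v x)) s μ := by
  obtain ⟨C, hC⟩ := hK.exists_bound_of_continuousOn hv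
  refine Integrable.mono' (hb.norm.mul_const C)
    (hb.aestronglyMeasurable.inner ((hv.mono hsK).aestronglyMeasurable hs)) ?_
  filter_upwards [ae_restrict_mem hs] with x hx
  exact (norm_inner_le_norm _ _).trans (mul_le_mul_of_nonneg_left (hC x (hsK hx)) (norm_nonneg _))

theorem load_add {Ω ΓD : Set Plane} (hΩ : IsPolygonalDomain Ω) (hΓD : MeasurableSet ΓD)
    {b t : Plane → Plane} (hb : IntegrableOn b Ω volume)
    (ht : IntegrableOn t (frontier Ω \ ΓD) (Measure.hausdorffMeasure 1)) {u v : Plane → Plane}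
    (hu : ContinuousOn u (closure Ω)) (hv : ContinuousOn v (closure Ω)) :
    load Ω ΓD b t (u + v) = load Ω ΓD b t u + load Ω ΓD b t v := by
  have hK : IsCompact (closure Ω) := hΩ.isBounded.isCompact_closure
  have hm : MeasurableSet (frontier Ω \ ΓD) := isClosed_frontier.measurableSet.diff hΓD
  have hsub : frontier Ω \ ΓD ⊆ closure Ω := Set.sdiff_subset.trans frontier_subset_closure
  have hb' := fun {w} => integrableOn_inner (v := w) hb hΩ.isOpen.measurableSet hK subset_closure
  have ht' := fun {w} => integrableOn_inner (v := w) ht hm hK hsub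
  simp only [load, Pi.add_apply, inner_add_right]
  rw [integral_add (hb' hu) (hb' hv), integral_add (ht' hu) (ht' hv)]
  ring

theorem load_smul (Ω ΓD : Set Plane) (b t : Plane → Plane) (c : ℝ) (u : Plane → Plane) :
    load Ω ΓD b t (c • u) = c * load Ω ΓD b t u := by
  simp only [load, Pi.smul_apply, inner_smul_right, integral_const_mul]
  ring

/-! ### Strains of affine maps -/

/-- The strain of a linear displacement field. -/
def linStrain (L : Plane →ₗ[ℝ] Plane) : Voigt :=
  ![L (EuclideanSpace.single 0 1) 0, L (EuclideanSpace.single 1 1) 1,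
    L (EuclideanSpace.single 1 1) 0 + L (EuclideanSpace.single 0 1) 1]

theorem linStrain_add (L M : Plane →ₗ[ℝ] Plane) :
    linStrain (L + M) = linStrain L + linStrain M := by
  ext i
  fin_cases i <;> simp [linStrain]
  ring

theorem linStrain_smul (c : ℝ) (L : Plane →ₗ[ℝ] Plane) :
    linStrain (c • L) = c • linStrain L := by
  ext i
  fin_cases i <;> simp [linStrain]
  ring

theorem strain_eq_linStrain {u : Plane → Plane} {g : Plane →ᵃ[ℝ] Plane} {K : Set Plane}
    (h : Set.EqOn u g K) {x : Plane} (hx : x ∈ interior K) : strain u x = linStrain g.linear := by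
  have hg : HasFDerivAt g (LinearMap.toContinuousLinearMap g.linear) x := by
    rw [AffineMap.decomp g]
    exact (LinearMap.toContinuousLinearMap g.linear).hasFDerivAt.add_const (g 0)
  have hu : HasFDerivAt u (LinearMap.toContinuousLinearMap g.linear) x :=
    hg.congr_of_eventuallyEq (h.eventuallyEq_of_mem (mem_interior_iff_mem_nhds.1 hx))
  simp [strain, hu.fderiv, linStrain]

/-- The values of `fderiv` are controlled only in the interior of `K`; the frontier of a convex set
is null. -/
theorem setIntegral_strain {u : Plane → Plane} {g : Plane →ᵃ[ℝ] Plane} {K : Set Plane}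
    (hK : Convex ℝ K) (h : Set.EqOn u g K) :
    ∫ x in K, strain u x = volume.real K • linStrain g.linear := by
  have hae : interior K =ᵐ[volume] K := interior_ae_eq_of_null_frontier (hK.addHaar_frontier _)
  rw [← setIntegral_congr_set hae, setIntegral_congr_fun isOpen_interior.measurableSet
    (fun x hx => strain_eq_linStrain h hx), setIntegral_const, measureReal_congr hae]

theorem setIntegral_strain_add {u v : Plane → Plane} {K : Set Plane} (hK : Convex ℝ K)
    (hu : IsAffineOn u K) (hv : IsAffineOn v K) :
    ∫ x in K, strain (u + v) x = (∫ x in K, strain u x) + ∫ x in K, strain v x := by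
  obtain ⟨g, hg⟩ := hu
  obtain ⟨k, hk⟩ := hv
  rw [setIntegral_strain hK hg, setIntegral_strain hK hk,
    setIntegral_strain (g := g + k) hK (fun x hx => by simp [hg hx, hk hx]), AffineMap.add_linear,
    linStrain_add, smul_add]

theorem setIntegral_strain_smul {u : Plane → Plane} {K : Set Plane} (hK : Convex ℝ K)
    (c : ℝ) (hu : IsAffineOn u K) :
    ∫ x in K, strain (c • u) x = c • ∫ x in K, strain u x := by
  obtain ⟨g, hg⟩ := hu
  rw [setIntegral_strain hK hg,
    setIntegral_strain (g := c • g) hK (fun x hx => by simp [hg hx]), AffineMap.smul_linear,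
    linStrain_smul, smul_comm]

/-- The coefficient of elongation in the direction `t`, multiplied by `‖t‖²`. -/
def elongation (ε : Voigt) (t : Plane) : ℝ :=
  ε 0 * t 0 ^ 2 + ε 1 * t 1 ^ 2 + ε 2 * (t 0 * t 1)

theorem linear_apply (L : Plane →ₗ[ℝ] Plane) (t : Plane) (k : Fin 2) :
    L t k = t 0 * L (EuclideanSpace.single 0 1) k + t 1 * L (EuclideanSpace.single 1 1) k := by
  have h : t = t 0 • EuclideanSpace.single 0 1 + t 1 • EuclideanSpace.single 1 1 := by
    apply Plane.ext <;> simp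
  conv_lhs => rw [h]
  simp

theorem elongation_linStrain (L : Plane →ₗ[ℝ] Plane) (t : Plane) :
    elongation (linStrain L) t = L t 0 * t 0 + L t 1 * t 1 := by
  rw [linear_apply L t 0, linear_apply L t 1]
  simp [elongation, linStrain]
  ring

/-- The strain of a linear map in terms of its values at two vectors. -/
theorem cross_smul_linStrain (L : Plane →ₗ[ℝ] Plane) (a b : Plane) :
    cross a b • linStrain L =
      ![b 1 * L a 0 - a 1 * L b 0, a 0 * L b 1 - b 0 * L a 1,
        a 0 * L b 0 - b 0 * L a 0 + (b 1 * L a 1 - a 1 * L b 1)] := by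
  have h := linear_apply L
  ext i
  fin_cases i <;> simp [linStrain, cross, h a 0, h a 1, h b 0, h b 1] <;> ring

/-! ### The area of a triangle -/

/-- Only the proportionality of area and cross product matters later, so the constant stays the area
of the reference triangle. -/
theorem volume_triangle (p q r : Plane) :
    volume.real (convexHull ℝ {p, q, r}) = |cross (q - p) (r - p)| *
      volume.real (convexHull ℝ {0, EuclideanSpace.single 0 1, EuclideanSpace.single 1 1} :
        Set Plane) := by
  set A : Matrix (Fin 2) (Fin 2) ℝ := !![q 0 - p 0, r 0 - p 0; q 1 - p 1, r 1 - p 1] with hA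
  set L : Plane →ₗ[ℝ] Plane := Matrix.toEuclideanLin A
  have hdet : LinearMap.det L = cross (q - p) (r - p) := by
    simp only [L, Matrix.toLpLin_eq_toLin, LinearMap.det_toLin]
    simp [hA, Matrix.det_fin_two, cross]
    ring
  have himg : convexHull ℝ {p, q, r} = (fun x => p + x) ''
      (L '' convexHull ℝ {0, EuclideanSpace.single 0 1, EuclideanSpace.single 1 1}) := by
    rw [L.image_convexHull]
    have h : (fun x => p + x) = (AffineEquiv.constVAdd ℝ Plane p).toAffineMap := by
      ext; simp
    rw [h, AffineMap.image_convexHull]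
    congr 1
    simp only [Set.image_insert_eq, Set.image_singleton]
    congr 1
    · simp
    · have h0 : L (EuclideanSpace.single 0 1) = q - p := by
        apply Plane.ext <;> simp [L, hA, Matrix.toLpLin_apply]
      have h1 : L (EuclideanSpace.single 1 1) = r - p := by
        apply Plane.ext <;> simp [L, hA, Matrix.toLpLin_apply]
      simp [h0, h1]
  rw [himg, Set.image_add_left, measureReal_def, measure_preimage_add,
    Measure.addHaar_image_linearMap, ENNReal.toReal_mul, hdet, ENNReal.toReal_ofReal (abs_nonneg _)]
  rfl

theorem volume_real_pos {K : Set Plane} (hK : IsCompact K) (h : (interior K).Nonempty) :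
    0 < volume.real K :=
  ENNReal.toReal_pos ((isOpen_interior.measure_pos volume h).trans_le
    (measure_mono interior_subset)).ne' hK.measure_ne_top

/-! ### Infinitesimal rigid motions -/

/-- The infinitesimal rigid motion with rotation `ω` and translation `d`. -/
def rigid (ω : ℝ) (d : Plane) : Plane →ᵃ[ℝ] Plane :=
  (Matrix.toEuclideanLin !![0, -ω; ω, 0]).toAffineMap + AffineMap.const ℝ Plane d

theorem rigid_zero (ω : ℝ) (d x : Plane) : rigid ω d x 0 = d 0 - ω * x 1 := by
  simp [rigid, Matrix.toLpLin_apply, dotProduct, Fin.sum_univ_two]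
  ring

theorem rigid_one (ω : ℝ) (d x : Plane) : rigid ω d x 1 = d 1 + ω * x 0 := by
  simp [rigid, Matrix.toLpLin_apply, dotProduct, Fin.sum_univ_two]
  ring

/-- Subtracting the equations at `p` and `q` leaves `(ω - ω')` times the rotated vector `p - q`. -/
theorem rigid_unique {ω ω' : ℝ} {d d' p q : Plane} (hpq : p ≠ q)
    (hp : rigid ω d p = rigid ω' d' p) (hq : rigid ω d q = rigid ω' d' q) : ω = ω' ∧ d = d' := by
  have p0 := congrArg (fun x : Plane => x 0) hp
  have p1 := congrArg (fun x : Plane => x 1) hp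
  have q0 := congrArg (fun x : Plane => x 0) hq
  have q1 := congrArg (fun x : Plane => x 1) hq
  simp only [rigid_zero, rigid_one] at p0 p1 q0 q1
  have hω : ω = ω' := by
    by_contra hne
    have hne' : ω - ω' ≠ 0 := sub_ne_zero.2 hne
    refine hpq (Plane.ext ?_ ?_)
    · refine mul_left_cancel₀ hne' ?_
      linear_combination p1 - q1
    · refine mul_left_cancel₀ hne' ?_
      linear_combination q0 - p0
  subst hω
  exact ⟨rfl, Plane.ext (by linarith) (by linarith)⟩

/-- Affine maps without strain are infinitesimal rigid motions. -/
theorem exists_rigid_of_linStrain_eq_zero {g : Plane →ᵃ[ℝ] Plane} (h : linStrain g.linear = 0) :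
    ∃ ω d, ∀ x, g x = rigid ω d x := by
  have h0 := congrFun h 0
  have h1 := congrFun h 1
  have h2 := congrFun h 2
  simp only [linStrain, Matrix.cons_val, Pi.zero_apply] at h0 h1 h2
  -- Without strain the matrix of the linear part is antisymmetric; its lower left entry is the
  -- rotation.
  refine ⟨g.linear (EuclideanSpace.single 0 1) 1, g 0, fun x => ?_⟩
  have hx : g x = g.linear x + g 0 := congrFun (AffineMap.decomp g) x
  rw [hx]
  apply Plane.ext
  · rw [rigid_zero, PiLp.add_apply, linear_apply]
    linear_combination x 0 * h0 + x 1 * h2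
  · rw [rigid_one, PiLp.add_apply, linear_apply]
    linear_combination x 1 * h1

/-- A strain without elongation in the directions of the sides of a triangle vanishes. -/
theorem eq_zero_of_elongation {ε : Voigt} {a b : Plane} (hab : cross a b ≠ 0)
    (ha : elongation ε a = 0) (hb : elongation ε b = 0) (hc : elongation ε (-(a + b)) = 0) :
    ε = 0 := by
  simp only [elongation, PiLp.neg_apply, PiLp.add_apply] at ha hb hc
  have hab' : (a 0 * b 1 - a 1 * b 0) ^ 2 ≠ 0 := pow_ne_zero 2 hab
  ext i
  fin_cases i
  · refine (mul_eq_zero.1 (?_ : (a 0 * b 1 - a 1 * b 0) ^ 2 * ε 0 = 0)).resolve_left hab'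
    -- The elongation is a quadratic form, and `b 1 • a - a 1 • b` is `cross a b` times the first
    -- unit vector. Its value there is expanded by polarization; the other two components are found
    -- likewise.
    linear_combination (b 1 ^ 2 + a 1 * b 1) * ha + (a 1 ^ 2 + a 1 * b 1) * hb - a 1 * b 1 * hc
  · refine (mul_eq_zero.1 (?_ : (a 0 * b 1 - a 1 * b 0) ^ 2 * ε 1 = 0)).resolve_left hab'
    linear_combination (b 0 ^ 2 + a 0 * b 0) * ha + (a 0 ^ 2 + a 0 * b 0) * hb - a 0 * b 0 * hc
  · refine (mul_eq_zero.1 (?_ : (a 0 * b 1 - a 1 * b 0) ^ 2 * ε 2 = 0)).resolve_left hab'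
    linear_combination (-2 * b 0 * b 1 - (a 0 * b 1 + a 1 * b 0)) * ha +
      (-2 * a 0 * a 1 - (a 0 * b 1 + a 1 * b 0)) * hb + (a 0 * b 1 + a 1 * b 0) * hc

theorem elongation_add (ε ε' : Voigt) (t : Plane) :
    elongation (ε + ε') t = elongation ε t + elongation ε' t := by
  simp only [elongation, Pi.add_apply]
  ring

theorem elongation_smul (c : ℝ) (ε : Voigt) (t : Plane) :
    elongation (c • ε) t = c * elongation ε t := by
  simp only [elongation, Pi.smul_apply, smul_eq_mul]
  ring

/-- The elongation of a side depends only on the displacements of its endpoints. -/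
theorem elongation_of_eqOn {u : Plane → Plane} {g : Plane →ᵃ[ℝ] Plane} {K : Set Plane}
    (h : Set.EqOn u g K) {p q : Plane} (hp : p ∈ K) (hq : q ∈ K) :
    elongation (linStrain g.linear) (q - p) =
      (u q 0 - u p 0) * (q 0 - p 0) + (u q 1 - u p 1) * (q 1 - p 1) := by
  have hL : g.linear (q - p) = u q - u p := by
    rw [h hq, h hp]
    exact AffineMap.linearMap_vsub g q p
  rw [elongation_linStrain, hL]
  simp

theorem eqOn_convexHull {g k : Plane →ᵃ[ℝ] Plane} {s : Set Plane} (h : Set.EqOn g k s) :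
    Set.EqOn g k (convexHull ℝ s) := by
  have hs : s ⊆ (g - k) ⁻¹' {0} := fun x hx => by simp [h hx]
  intro x hx
  have := convexHull_min hs ((convex_singleton 0).affine_preimage (g - k)) hx
  simpa [sub_eq_zero] using this

theorem infinite_of_hausdorffMeasure_pos {s : Set Plane}
    (h : 0 < (Measure.hausdorffMeasure 1 : Measure Plane) s) : s.Infinite := by
  intro hfin
  have := Measure.nullSingletonClass_hausdorff Plane (d := 1) one_pos
  exact h.ne' (hfin.measure_zero _)

/-- Positive length leaves at least two points of `ΓD` at which `u` vanishes, and a rigid motion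
that is zero at two points is zero. -/
theorem eq_zero_of_eqOn_rigid {Ω ΓD : Set Plane} (hΓD : ΓD ⊆ frontier Ω)
    (hΓD_pos : 0 < (Measure.hausdorffMeasure 1 : Measure Plane) ΓD) (hm : MeasurableSet ΓD)
    {u : Plane → Plane} (hu : u ∈ continuousFields Ω ΓD) {ω : ℝ} {d : Plane}
    (h : Set.EqOn u (rigid ω d) (closure Ω)) : u = 0 := by
  obtain ⟨-, hout, hae⟩ := hu
  rw [ae_restrict_iff' hm] at hae
  have hinf : (ΓD ∩ {x | u x = 0}).Infinite := by
    apply infinite_of_hausdorffMeasure_pos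
    refine hΓD_pos.trans_le (measure_mono_ae ?_)
    filter_upwards [hae] with x hx hxΓ
    exact ⟨hxΓ, hx hxΓ⟩
  obtain ⟨p, hp, q, hq, hpq⟩ := hinf.nontrivial
  have key : ∀ x ∈ ΓD ∩ {x | u x = 0}, rigid ω d x = rigid 0 0 x := by
    rintro x ⟨hx, hx0⟩
    rw [← h (frontier_subset_closure (hΓD hx)), hx0]
    apply Plane.ext <;> simp [rigid_zero, rigid_one]
  obtain ⟨rfl, rfl⟩ := rigid_unique hpq (key p hp) (key q hq)
  funext x
  by_cases hx : x ∈ closure Ω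
  · rw [h hx]
    apply Plane.ext <;> simp [rigid_zero, rigid_one]
  · exact hout x hx

/-! ### From elements to the mesh: gluing rigid motions, nodal values, piecewise fields. -/

namespace Mesh

section

variable {n : ℕ} [NeZero n] {Ω : Set Plane} {𝒯 : Mesh n Ω}

/-- A displacement field that is a rigid motion on the nodes of each element is one on all
nodes. -/
theorem exists_rigid (h𝒯 : ∀ T, IsConvexPolygon (𝒯.node T)) (hΩ : IsPolygonalDomain Ω)
    {u : Plane → Plane}
    (h : ∀ T, ∃ ω d, ∀ k, u (𝒯.node T k) = rigid ω d (𝒯.node T k)) :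
    ∃ ω d, ∀ T k, u (𝒯.node T k) = rigid ω d (𝒯.node T k) := by
  obtain ⟨x, hx⟩ := hΩ.isConnected.nonempty
  obtain ⟨T₀, -⟩ := 𝒯.exists_mem_cell (subset_closure hx)
  obtain ⟨ω, d, h₀⟩ := h T₀
  refine ⟨ω, d, edge_induction h𝒯 hΩ _ ?_ ⟨T₀, h₀⟩⟩
  intro T i T' j hadj hT
  obtain ⟨ω', d', h'⟩ := h T'
  have hne : 𝒯.node T' j ≠ 𝒯.node T' (j + 1) := fun h =>
    (h𝒯 T').add_one_ne j ((h𝒯 T').injective h).symm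
  obtain ⟨e0, e1⟩ := hadj.node_eq h𝒯
  obtain ⟨rfl, rfl⟩ := rigid_unique (ω := ω) (ω' := ω') (d := d) (d' := d') hne
    (by rw [← h', e0, hT]) (by rw [← h', e1, hT])
  exact h'

/-- A displacement field is determined by its nodal values. -/
theorem finiteDimensional_of_nodes (𝒯 : Mesh n Ω) (V : Submodule ℝ (Plane → Plane))
    (h : ∀ u ∈ V, (∀ T k, u (𝒯.node T k) = 0) → u = 0) : FiniteDimensional ℝ V := by
  let N : (Plane → Plane) →ₗ[ℝ] (Fin 𝒯.numElements → Fin n → Plane) :=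
    { toFun := fun u T k => u (𝒯.node T k)
      map_add' := fun _ _ => rfl
      map_smul' := fun _ _ => rfl }
  refine Module.Finite.of_injective (N.domRestrict V) ?_
  rw [injective_iff_map_eq_zero]
  rintro ⟨u, hu⟩ hNu
  exact Subtype.ext (h u hu fun T k => congrFun (congrFun hNu T) k)

theorem sum_indicator_interior (𝒯 : Mesh n Ω) (F : Fin 𝒯.numElements → Plane → Voigt)
    {T : Fin 𝒯.numElements} {x : Plane} (hx : x ∈ interior (𝒯.cell T)) :
    ∑ T, (interior (𝒯.cell T)).indicator (F T) x = F T x := by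
  rw [Finset.sum_eq_single T, Set.indicator_of_mem hx]
  · intro T' _ hne
    refine Set.indicator_of_notMem (fun hx' => ?_) _
    exact Set.disjoint_left.1 (𝒯.disjoint_interior T' T hne) hx' hx
  · simp

theorem measurable_sum_indicator (𝒯 : Mesh n Ω) {F : Fin 𝒯.numElements → Plane → Voigt}
    (hF : ∀ T, Measurable (F T)) :
    Measurable fun x => ∑ T, (interior (𝒯.cell T)).indicator (F T) x :=
  Finset.measurable_sum _ fun T _ => (hF T).indicator isOpen_interior.measurableSet

theorem bounded_sum_indicator (𝒯 : Mesh n Ω) {F : Fin 𝒯.numElements → Plane → Voigt}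
    (hF : ∀ T, ∃ C, ∀ x ∈ 𝒯.cell T, ‖F T x‖ ≤ C) :
    ∃ C, ∀ x, ‖∑ T, (interior (𝒯.cell T)).indicator (F T) x‖ ≤ C := by
  choose C hC using hF
  refine ⟨∑ T, |C T|, fun x => (norm_sum_le _ _).trans (Finset.sum_le_sum fun T _ => ?_)⟩
  by_cases hx : x ∈ interior (𝒯.cell T)
  · rw [Set.indicator_of_mem hx]
    exact (hC T x (interior_subset hx)).trans (le_abs_self _)
  · rw [Set.indicator_of_notMem hx, norm_zero]
    exact abs_nonneg _

theorem volume_cell_pos (h𝒯 : ∀ T, IsConvexPolygon (𝒯.node T)) (T : Fin 𝒯.numElements) :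
    0 < volume.real (𝒯.cell T) :=
  volume_real_pos (𝒯.isCompact_cell T) (nonempty_interior_cell h𝒯 T)

/-- If the smoothed strain vanishes almost everywhere, so does its expression on the interior
of each element, wherever that is continuous. -/
theorem eqOn_zero_of_ae (𝒯 : Mesh n Ω) (hΩ : IsPolygonalDomain Ω)
    {F : Fin 𝒯.numElements → Plane → Voigt}
    (h : (fun x => ∑ T, (interior (𝒯.cell T)).indicator (F T) x) =ᵐ[volume.restrict Ω] 0)
    (T : Fin 𝒯.numElements) {U : Set Plane} (hU : IsOpen U) (hUT : U ⊆ 𝒯.cell T)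
    (hF : ContinuousOn (F T) U) : Set.EqOn (F T) 0 U := by
  have hUi : U ⊆ interior (𝒯.cell T) := interior_maximal hUT hU
  refine Measure.eqOn_open_of_ae_eq (μ := volume) ?_ hU hF continuousOn_const
  filter_upwards [ae_restrict_of_ae_restrict_of_subset
    (hUi.trans (𝒯.interior_cell_subset hΩ T)) h, ae_restrict_mem hU.measurableSet] with x hx hxU
  rw [← 𝒯.sum_indicator_interior F (hUi hxU)]
  exact hx

end

/-! ### The triangular element -/

section

variable {Ω ΓD : Set Plane} {𝒯 : Mesh 3 Ω}

theorem isConvexPolygon_three (𝒯 : Mesh 3 Ω) (T : Fin 𝒯.numElements) :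
    IsConvexPolygon (𝒯.node T) :=
  SSE.isConvexPolygon_three (𝒯.counterclockwise T)

theorem tri_eqOn_closure (𝒯 : Mesh 3 Ω) {u v : Plane → Plane}
    (hu : ∀ T, IsAffineOn u (𝒯.cell T)) (hv : ∀ T, IsAffineOn v (𝒯.cell T))
    (h : ∀ T k, u (𝒯.node T k) = v (𝒯.node T k)) : Set.EqOn u v (closure Ω) := by
  intro x hx
  obtain ⟨T, hT⟩ := 𝒯.exists_mem_cell hx
  obtain ⟨g, hg⟩ := hu T
  obtain ⟨k, hk⟩ := hv T
  rw [hg hT, hk hT]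
  refine eqOn_convexHull ?_ hT
  rintro _ ⟨j, rfl⟩
  rw [← hg (𝒯.node_mem_cell T j), ← hk (𝒯.node_mem_cell T j), h]

theorem finiteDimensional_triSpace (𝒯 : Mesh 3 Ω) (ΓD : Set Plane) :
    FiniteDimensional ℝ (𝒯.triSpace ΓD) := by
  refine 𝒯.finiteDimensional_of_nodes _ fun u hu h0 => ?_
  funext x
  by_cases hx : x ∈ closure Ω
  · exact 𝒯.tri_eqOn_closure hu.2 (fun T => IsAffineOn.zero _) (fun T k => h0 T k) hx
  · exact hu.1.2.1 x hx

theorem triGaussPoint_mem_interior (𝒯 : Mesh 3 Ω) (T : Fin 𝒯.numElements) (i : Fin 3) :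
    𝒯.triGaussPoint T i ∈ interior (𝒯.cell T) := by
  refine (𝒯.isConvexPolygon_three T).mem_interior fun k => ?_
  have h := 𝒯.counterclockwise T k
  have : cross (𝒯.node T (k + 1) - 𝒯.node T k) (𝒯.triGaussPoint T i - 𝒯.node T k) =
      -- The factor is the barycentric coordinate of the Gaussian point at the node opposite to the
      -- edge `k`.
      (if i = k + 2 then 2 / 3 else 1 / 6) *
        cross (𝒯.node T (k + 1) - 𝒯.node T k) (𝒯.node T (k + 2) - 𝒯.node T (k + 1)) := by
    fin_cases k <;> fin_cases i <;> simp [cross, triGaussPoint] <;> ring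
  rw [this]
  split_ifs <;> positivity

theorem continuous_triInterpolate (𝒯 : Mesh 3 Ω) (T : Fin 𝒯.numElements) (g : Fin 3 → Voigt) :
    Continuous (𝒯.triInterpolate T g) := by
  unfold triInterpolate barycentric
  have := fun i => continuous_cross (f := fun x => 𝒯.node T (i + 1) - x)
    (g := fun x => 𝒯.node T (i + 2) - x) (by fun_prop) (by fun_prop)
  fun_prop

theorem triGaussValue_eq_zero (hΩ : IsPolygonalDomain Ω) {ε : Plane → Voigt}
    (h : 𝒯.triSmooth ε =ᵐ[volume.restrict Ω] 0) (T : Fin 𝒯.numElements) (i : Fin 3) :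
    𝒯.triGaussValue ε T i = 0 := by
  have := 𝒯.eqOn_zero_of_ae hΩ (F := fun T => 𝒯.triInterpolate T (𝒯.triGaussValue ε T)) h T
    isOpen_interior interior_subset (𝒯.continuous_triInterpolate T _).continuousOn
    (𝒯.triGaussPoint_mem_interior T i)
  simpa [triInterpolate_triGaussPoint] using this

/-- Each mean is the negative of its cyclic predecessor; after three sign changes it is its own
negative. -/
theorem triIntermediate_eq_zero {ε : Plane → Voigt} {T : Fin 𝒯.numElements}
    (h : ∀ i, 𝒯.triGaussValue ε T i = 0) (i : Fin 3) : 𝒯.triIntermediate ε T i = 0 := by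
  have h' : ∀ i, 𝒯.triIntermediate ε T (i - 1) + 𝒯.triIntermediate ε T i = 0 := fun i =>
    (smul_eq_zero.1 (h i)).resolve_left (by norm_num)
  have h0 := h' i
  have h1 := h' (i + 1)
  have h2 := h' (i + 2)
  obtain ⟨e1, e2, e3⟩ : i + 1 - 1 = i ∧ i + 2 - 1 = i + 1 ∧ i + 2 = i - 1 := by
    clear h0 h1 h2
    decide +revert
  rw [e1] at h1
  rw [e2, e3] at h2
  ext k
  have a0 := congrFun h0 k
  have a1 := congrFun h1 k
  have a2 := congrFun h2 k
  simp only [Pi.add_apply, Pi.zero_apply] at a0 a1 a2 ⊢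
  linarith

theorem triSpace_eq_zero (hΩ : IsPolygonalDomain Ω) (hΓD : ΓD ⊆ frontier Ω)
    (hm : MeasurableSet ΓD) (hΓD_pos : 0 < (Measure.hausdorffMeasure 1 : Measure Plane) ΓD)
    {u : Plane → Plane} (hu : u ∈ 𝒯.triSpace ΓD)
    (h : 𝒯.triSmooth (strain u) =ᵐ[volume.restrict Ω] 0) : u = 0 := by
  have h𝒯 := 𝒯.isConvexPolygon_three
  have hvol := volume_cell_pos h𝒯
  choose g hg using hu.2
  have hI := fun T => triIntermediate_eq_zero (triGaussValue_eq_zero hΩ h T)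
  -- The vanishing edge mean weights two strains that elongate the common edge equally, so this
  -- elongation times the total area is zero.
  have hel : ∀ T i, elongation (linStrain (g T).linear) (𝒯.node T (i + 1) - 𝒯.node T i) = 0 := by
    intro T i
    have hT := hI T i
    have hT' := hvol (𝒯.neighbor T i).1
    rw [triIntermediate, setIntegral_strain (𝒯.convex_cell _) (hg _),
      setIntegral_strain (𝒯.convex_cell _) (hg _), smul_eq_zero,
      or_iff_right (inv_ne_zero (add_pos (hvol T) hT').ne')] at hT
    have he := congrArg (fun ε => elongation ε (𝒯.node T (i + 1) - 𝒯.node T i)) hT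
    simp only [elongation_add, elongation_smul] at he
    have h0 : elongation 0 (𝒯.node T (i + 1) - 𝒯.node T i) = 0 := by simp [elongation]
    have heq : elongation (linStrain (g (𝒯.neighbor T i).1).linear)
        (𝒯.node T (i + 1) - 𝒯.node T i) =
        elongation (linStrain (g T).linear) (𝒯.node T (i + 1) - 𝒯.node T i) := by
      rw [elongation_of_eqOn (hg T) (𝒯.node_mem_cell _ _) (𝒯.node_mem_cell _ _)]
      rcases 𝒯.neighbor_cases T i with hn | hn
      · rw [hn, elongation_of_eqOn (hg T) (𝒯.node_mem_cell _ _) (𝒯.node_mem_cell _ _)]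
      · obtain ⟨e0, e1⟩ := hn.node_eq h𝒯
        rw [elongation_of_eqOn (hg _) (e1 ▸ 𝒯.node_mem_cell _ _) (e0 ▸ 𝒯.node_mem_cell _ _)]
    rw [heq, h0, ← add_mul] at he
    exact (mul_eq_zero.1 he).resolve_left (add_pos (hvol T) hT').ne'
  have hzero : ∀ T, linStrain (g T).linear = 0 := by
    intro T
    refine eq_zero_of_elongation (a := 𝒯.node T 1 - 𝒯.node T 0) (b := 𝒯.node T 2 - 𝒯.node T 1)
      (𝒯.counterclockwise T 0).ne' (hel T 0) (hel T 1) ?_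
    convert hel T 2 using 2
    simp only [Fin.isValue, Fin.reduceAdd]
    abel
  obtain ⟨ω, d, hωd⟩ := exists_rigid h𝒯 hΩ (u := u) fun T => by
    obtain ⟨ω, d, h⟩ := exists_rigid_of_linStrain_eq_zero (hzero T)
    exact ⟨ω, d, fun k => by rw [hg T (𝒯.node_mem_cell T k), h]⟩
  exact eq_zero_of_eqOn_rigid hΓD hΓD_pos hm hu.1
    (𝒯.tri_eqOn_closure hu.2 (fun T => ⟨rigid ω d, fun _ _ => rfl⟩) hωd)

/-- `fderiv` need not be additive across edges, so additivity is read off from the cell integrals of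
affine pieces. -/
theorem triSmooth_add {u v : Plane → Plane} (hu : u ∈ 𝒯.triSpace ΓD) (hv : v ∈ 𝒯.triSpace ΓD) :
    𝒯.triSmooth (strain (u + v)) = 𝒯.triSmooth (strain u) + 𝒯.triSmooth (strain v) := by
  have hI : ∀ T i, 𝒯.triIntermediate (strain (u + v)) T i =
      𝒯.triIntermediate (strain u) T i + 𝒯.triIntermediate (strain v) T i := by
    intro T i
    simp only [triIntermediate, setIntegral_strain_add (𝒯.convex_cell _) (hu.2 _) (hv.2 _)]
    module
  have hG : ∀ T i, 𝒯.triGaussValue (strain (u + v)) T i =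
      𝒯.triGaussValue (strain u) T i + 𝒯.triGaussValue (strain v) T i := by
    intro T i
    simp only [triGaussValue, hI]
    module
  funext x
  simp only [triSmooth, Pi.add_apply, ← Finset.sum_add_distrib]
  refine Finset.sum_congr rfl fun T _ => ?_
  rw [← Pi.add_apply, ← Set.indicator_add']
  congr 1
  funext y
  simp only [triInterpolate, hG, smul_add, Finset.sum_add_distrib, Pi.add_apply]

theorem triSmooth_smul (c : ℝ) {u : Plane → Plane} (hu : u ∈ 𝒯.triSpace ΓD) :
    𝒯.triSmooth (strain (c • u)) = c • 𝒯.triSmooth (strain u) := by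
  have hI : ∀ T i, 𝒯.triIntermediate (strain (c • u)) T i =
      c • 𝒯.triIntermediate (strain u) T i := by
    intro T i
    simp only [triIntermediate, setIntegral_strain_smul (𝒯.convex_cell _) c (hu.2 _)]
    module
  have hG : ∀ T i, 𝒯.triGaussValue (strain (c • u)) T i =
      c • 𝒯.triGaussValue (strain u) T i := by
    intro T i
    simp only [triGaussValue, hI]
    module
  funext x
  simp only [triSmooth, Pi.smul_apply, Finset.smul_sum, ← Set.indicator_const_smul_apply]
  refine Finset.sum_congr rfl fun T _ => ?_
  congr 1
  funext y
  simp only [triInterpolate, hG, Finset.smul_sum, smul_comm c]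

theorem existsUnique_tri (𝒯 : Mesh 3 Ω) (hΩ : IsPolygonalDomain Ω) (hΓD : ΓD ⊆ frontier Ω)
    (hm : MeasurableSet ΓD) (hΓD_pos : 0 < (Measure.hausdorffMeasure 1 : Measure Plane) ΓD)
    {D : Matrix (Fin 3) (Fin 3) ℝ} (hD : D.PosDef) {b t : Plane → Plane}
    (hb : IntegrableOn b Ω volume)
    (ht : IntegrableOn t (frontier Ω \ ΓD) (Measure.hausdorffMeasure 1)) :
    ∃! u : Plane → Plane, u ∈ 𝒯.triSpace ΓD ∧
      ∀ v ∈ 𝒯.triSpace ΓD, 𝒯.triForm D u v = load Ω ΓD b t v := by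
  have := 𝒯.finiteDimensional_triSpace ΓD
  exact existsUnique_variational hΩ.isBounded.measure_lt_top hD (𝒯.triSpace ΓD)
    (fun u => 𝒯.triSmooth (strain u))
    (fun u hu v hv => triSmooth_add hu hv) (fun c u hu => triSmooth_smul c hu)
    (fun u _ => 𝒯.measurable_sum_indicator fun T => (𝒯.continuous_triInterpolate T _).measurable)
    (fun u _ => 𝒯.bounded_sum_indicator fun T =>
      (𝒯.isCompact_cell T).exists_bound_of_continuousOn
        (𝒯.continuous_triInterpolate T _).continuousOn)
    (fun u hu => triSpace_eq_zero hΩ hΓD hm hΓD_pos hu) (load Ω ΓD b t)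
    (fun u hu v hv => load_add hΩ hm hb ht hu.1.1 hv.1.1) (fun c u _ => load_smul Ω ΓD b t c u)

end

end Mesh

/-! ### The bilinear map of the quadrilateral element -/

namespace Mesh

variable {Ω ΓD : Set Plane} {𝒯 : Mesh 4 Ω}

theorem isConvexPolygon_four (𝒯 : Mesh 4 Ω) (T : Fin 𝒯.numElements) :
    IsConvexPolygon (𝒯.node T) :=
  SSE.isConvexPolygon_four (𝒯.counterclockwise T)

theorem center_eq (𝒯 : Mesh 4 Ω) (T : Fin 𝒯.numElements) :
    𝒯.center T = (1 / 4 : ℝ) • ∑ i, 𝒯.node T i := by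
  simp [center, quadMap, Finset.smul_sum]

/-- The derivative of the bilinear map in the direction of the first natural coordinate. -/
def quadDeriv₁ (𝒯 : Mesh 4 Ω) (T : Fin 𝒯.numElements) (p : ℝ × ℝ) : Plane :=
  (1 / 4 : ℝ) • ((1 - p.2) • (𝒯.node T 1 - 𝒯.node T 0) + (1 + p.2) • (𝒯.node T 2 - 𝒯.node T 3))

/-- The derivative of the bilinear map in the direction of the second natural coordinate. -/
def quadDeriv₂ (𝒯 : Mesh 4 Ω) (T : Fin 𝒯.numElements) (p : ℝ × ℝ) : Plane :=
  (1 / 4 : ℝ) • ((1 - p.1) • (𝒯.node T 3 - 𝒯.node T 0) + (1 + p.1) • (𝒯.node T 2 - 𝒯.node T 1))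

/-- The reference square. -/
def refSquare : Set (ℝ × ℝ) := Set.Icc (-1 : ℝ) 1 ×ˢ Set.Icc (-1 : ℝ) 1

/-- The bilinear shape functions. -/
def shape (i : Fin 4) (p : ℝ × ℝ) : ℝ := (1 + (refNode i).1 * p.1) * (1 + (refNode i).2 * p.2) / 4

theorem shape_nonneg {p : ℝ × ℝ} (hp : p ∈ refSquare) (i : Fin 4) : 0 ≤ shape i p := by
  obtain ⟨⟨h1, h2⟩, h3, h4⟩ := hp
  refine div_nonneg (mul_nonneg ?_ ?_) (by norm_num) <;> fin_cases i <;> simp [refNode] <;> linarith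

theorem sum_shape (p : ℝ × ℝ) : ∑ i, shape i p = 1 := by
  simp [shape, refNode, Fin.sum_univ_four]
  ring

/-- The Jacobian has degree at most one in each natural coordinate, so the shape functions reproduce
it from its values at the nodes, which are a quarter of the positive corner cross products. -/
theorem cross_quadDeriv_pos (𝒯 : Mesh 4 Ω) (T : Fin 𝒯.numElements) {p : ℝ × ℝ}
    (hp : p ∈ refSquare) : 0 < cross (𝒯.quadDeriv₁ T p) (𝒯.quadDeriv₂ T p) := by
  have hJ : cross (𝒯.quadDeriv₁ T p) (𝒯.quadDeriv₂ T p) = ∑ i, shape i p * (1 / 4 *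
      cross (𝒯.node T (i - 1 + 1) - 𝒯.node T (i - 1))
        (𝒯.node T (i - 1 + 2) - 𝒯.node T (i - 1 + 1))) := by
    have e0 : (0 - 1 : Fin 4) = 3 := rfl
    have e1 : (1 - 1 : Fin 4) = 0 := rfl
    have e2 : (2 - 1 : Fin 4) = 1 := rfl
    have e3 : (3 - 1 : Fin 4) = 2 := rfl
    have f0 : (3 + 1 : Fin 4) = 0 := rfl
    have f1 : (0 + 1 : Fin 4) = 1 := rfl
    have f2 : (1 + 1 : Fin 4) = 2 := rfl
    have f3 : (2 + 1 : Fin 4) = 3 := rfl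
    have g0 : (3 + 2 : Fin 4) = 1 := rfl
    have g1 : (0 + 2 : Fin 4) = 2 := rfl
    have g2 : (1 + 2 : Fin 4) = 3 := rfl
    have g3 : (2 + 2 : Fin 4) = 0 := rfl
    simp only [Fin.sum_univ_four, e0, e1, e2, e3, f0, f1, f2, f3, g0, g1, g2, g3]
    simp [shape, refNode, cross, quadDeriv₁, quadDeriv₂]
    ring
  have hc := fun i => 𝒯.counterclockwise T (i - 1)
  rw [hJ]
  refine Finset.sum_pos' (fun i _ => mul_nonneg (shape_nonneg hp i) ?_) ?_
  · have := hc i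
    positivity
  · by_contra! hno
    have : ∑ i, shape i p = 0 := Finset.sum_eq_zero fun i _ => by
      have h := hno i (Finset.mem_univ _)
      have h' := hc i
      by_contra hne
      have : 0 < shape i p := lt_of_le_of_ne (shape_nonneg hp i) (Ne.symm hne)
      exact absurd h (not_le.2 (by positivity))
    rw [sum_shape] at this
    exact one_ne_zero this

theorem quadMap_mem_cell (𝒯 : Mesh 4 Ω) (T : Fin 𝒯.numElements) {p : ℝ × ℝ}
    (hp : p ∈ refSquare) : 𝒯.quadMap T p ∈ 𝒯.cell T :=
  sum_smul_mem_convexHull (shape_nonneg hp) (sum_shape p)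

/-- The mean value theorem is exact for bilinear maps. -/
theorem quadMap_sub (𝒯 : Mesh 4 Ω) (T : Fin 𝒯.numElements) (p q : ℝ × ℝ) :
    𝒯.quadMap T p - 𝒯.quadMap T q = (p.1 - q.1) • 𝒯.quadDeriv₁ T ((1 / 2 : ℝ) • (p + q)) +
      (p.2 - q.2) • 𝒯.quadDeriv₂ T ((1 / 2 : ℝ) • (p + q)) := by
  apply Plane.ext <;>
    simp [quadMap, refNode, Fin.sum_univ_four, quadDeriv₁, quadDeriv₂] <;> ring

/-- By `quadMap_sub`, the difference of two values is the derivative at the midpoint, which is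
nonsingular, applied to `p - q`. -/
theorem injOn_quadMap (𝒯 : Mesh 4 Ω) (T : Fin 𝒯.numElements) :
    Set.InjOn (𝒯.quadMap T) refSquare := by
  intro p hp q hq hpq
  have hm : (1 / 2 : ℝ) • (p + q) ∈ refSquare := by
    have hconv : Convex ℝ refSquare := (convex_Icc _ _).prod (convex_Icc _ _)
    rw [smul_add]
    exact hconv hp hq (by norm_num) (by norm_num) (by norm_num)
  have hJ := (𝒯.cross_quadDeriv_pos T hm).ne'
  have h := 𝒯.quadMap_sub T p q
  rw [hpq, sub_self] at h
  generalize 𝒯.quadDeriv₁ T ((1 / 2 : ℝ) • (p + q)) = a at h hJ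
  generalize 𝒯.quadDeriv₂ T ((1 / 2 : ℝ) • (p + q)) = b at h hJ
  have h0 := congrArg (fun x : Plane => x 0) h
  have h1 := congrArg (fun x : Plane => x 1) h
  simp only [PiLp.zero_apply, PiLp.add_apply, PiLp.smul_apply, smul_eq_mul] at h0 h1
  unfold cross at hJ
  refine Prod.ext (sub_eq_zero.1 (mul_left_cancel₀ hJ ?_))
    (sub_eq_zero.1 (mul_left_cancel₀ hJ ?_))
  · linear_combination -b 1 * h0 + b 0 * h1
  · linear_combination -a 0 * h1 + a 1 * h0

theorem continuous_quadMap (𝒯 : Mesh 4 Ω) (T : Fin 𝒯.numElements) :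
    Continuous (𝒯.quadMap T) := by
  unfold quadMap
  fun_prop

theorem isCompact_refSquare : IsCompact refSquare := isCompact_Icc.prod isCompact_Icc

theorem naturalCoord_quadMap (𝒯 : Mesh 4 Ω) (T : Fin 𝒯.numElements) {p : ℝ × ℝ}
    (hp : p ∈ refSquare) : 𝒯.naturalCoord T (𝒯.quadMap T p) = p :=
  (𝒯.injOn_quadMap T).leftInvOn_invFunOn hp

theorem naturalCoord_of_notMem (𝒯 : Mesh 4 Ω) (T : Fin 𝒯.numElements) {x : Plane}
    (hx : x ∉ 𝒯.quadMap T '' refSquare) :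
    𝒯.naturalCoord T x = Classical.choice inferInstance :=
  Function.invFunOn_neg hx

theorem preimage_naturalCoord_inter (𝒯 : Mesh 4 Ω) (T : Fin 𝒯.numElements) (t : Set (ℝ × ℝ)) :
    𝒯.naturalCoord T ⁻¹' t ∩ 𝒯.quadMap T '' refSquare = 𝒯.quadMap T '' (t ∩ refSquare) := by
  ext x
  constructor
  · rintro ⟨hx, p, hp, rfl⟩
    rw [Set.mem_preimage, 𝒯.naturalCoord_quadMap T hp] at hx
    exact ⟨p, ⟨hx, hp⟩, rfl⟩
  · rintro ⟨p, ⟨hpt, hp⟩, rfl⟩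
    exact ⟨by rwa [Set.mem_preimage, 𝒯.naturalCoord_quadMap T hp], p, hp, rfl⟩

theorem isClosed_image_quadMap (𝒯 : Mesh 4 Ω) (T : Fin 𝒯.numElements) {t : Set (ℝ × ℝ)}
    (ht : IsClosed t) : IsClosed (𝒯.quadMap T '' (t ∩ refSquare)) :=
  ((isCompact_refSquare.inter_left ht).image (𝒯.continuous_quadMap T)).isClosed

theorem continuousOn_naturalCoord (𝒯 : Mesh 4 Ω) (T : Fin 𝒯.numElements) :
    ContinuousOn (𝒯.naturalCoord T) (𝒯.quadMap T '' refSquare) := by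
  rw [continuousOn_iff_isClosed]
  intro t ht
  refine ⟨_, 𝒯.isClosed_image_quadMap T ht, ?_⟩
  rw [𝒯.preimage_naturalCoord_inter, Set.inter_eq_left.2 (Set.image_mono Set.inter_subset_right)]

theorem measurable_naturalCoord (𝒯 : Mesh 4 Ω) (T : Fin 𝒯.numElements) :
    Measurable (𝒯.naturalCoord T) := by
  refine measurable_of_isClosed fun t ht => ?_
  have hK : MeasurableSet (𝒯.quadMap T '' refSquare) :=
    (isCompact_refSquare.image (𝒯.continuous_quadMap T)).isClosed.measurableSet
  rw [← Set.inter_union_sdiff (𝒯.naturalCoord T ⁻¹' t) (𝒯.quadMap T '' refSquare),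
    𝒯.preimage_naturalCoord_inter]
  refine (𝒯.isClosed_image_quadMap T ht).measurableSet.union ?_
  -- Off the image `invFunOn` has one constant default value, so there the preimage is everything or
  -- nothing.
  by_cases hc : (Classical.choice inferInstance : ℝ × ℝ) ∈ t
  · convert hK.compl using 1
    ext x
    refine ⟨fun h => h.2, fun h => ⟨?_, h⟩⟩
    rwa [Set.mem_preimage, 𝒯.naturalCoord_of_notMem T h]
  · convert MeasurableSet.empty
    rw [Set.eq_empty_iff_forall_notMem]
    rintro x ⟨h, hx⟩
    rw [Set.mem_preimage, 𝒯.naturalCoord_of_notMem T hx] at h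
    exact hc h

theorem continuous_refInterpolate (g : Fin 4 → Voigt) : Continuous (refInterpolate g) := by
  unfold refInterpolate
  fun_prop

/-- Whether the bilinear map fills the cell is not needed: the compact set also includes the default
coordinate taken off its image. -/
theorem bounded_refInterpolate (𝒯 : Mesh 4 Ω) (T : Fin 𝒯.numElements) (g : Fin 4 → Voigt) :
    ∃ C, ∀ x ∈ 𝒯.cell T, ‖refInterpolate g (𝒯.naturalCoord T x)‖ ≤ C := by
  obtain ⟨C, hC⟩ := (isCompact_refSquare.insert
    (Classical.choice inferInstance : ℝ × ℝ)).exists_bound_of_continuousOn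
      (continuous_refInterpolate g).continuousOn
  refine ⟨C, fun x _ => hC _ ?_⟩
  by_cases hx : x ∈ 𝒯.quadMap T '' refSquare
  · obtain ⟨p, hp, rfl⟩ := hx
    rw [𝒯.naturalCoord_quadMap T hp]
    exact Or.inr hp
  · exact Or.inl (𝒯.naturalCoord_of_notMem T hx)

/-- The Jacobian is nonzero, so the strict derivative is onto and the map is locally open. Almost
everywhere vanishing can then be tested at the Gaussian points. -/
theorem isOpen_image_quadMap (𝒯 : Mesh 4 Ω) (T : Fin 𝒯.numElements) {U : Set (ℝ × ℝ)}
    (hU : IsOpen U) (hUs : U ⊆ refSquare) : IsOpen (𝒯.quadMap T '' U) := by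
  rw [isOpen_iff_mem_nhds]
  rintro _ ⟨p, hp, rfl⟩
  set C := 𝒯.quadMap T (0, 0)
  set A := 𝒯.quadDeriv₁ T (0, 0) with hA
  set B := 𝒯.quadDeriv₂ T (0, 0) with hB
  set H : Plane := (1 / 4 : ℝ) • (𝒯.node T 0 - 𝒯.node T 1 + 𝒯.node T 2 - 𝒯.node T 3) with hH
  have hF : 𝒯.quadMap T = fun p => C + p.1 • A + p.2 • B + (p.1 * p.2) • H := by
    funext p
    apply Plane.ext <;>
      simp [C, hA, hB, hH, quadMap, refNode, Fin.sum_univ_four, quadDeriv₁, quadDeriv₂] <;> ring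
  have h1 : HasStrictFDerivAt (fun p : ℝ × ℝ => p.1) (ContinuousLinearMap.fst ℝ ℝ ℝ) p :=
    hasStrictFDerivAt_fst
  have h2 : HasStrictFDerivAt (fun p : ℝ × ℝ => p.2) (ContinuousLinearMap.snd ℝ ℝ ℝ) p :=
    hasStrictFDerivAt_snd
  have hA' : HasStrictFDerivAt (fun p : ℝ × ℝ => p.1 • A) _ p := h1.smul_const A
  have hB' : HasStrictFDerivAt (fun p : ℝ × ℝ => p.2 • B) _ p := h2.smul_const B
  have hH' : HasStrictFDerivAt (fun p : ℝ × ℝ => (p.1 * p.2) • H) _ p := (h1.mul h2).smul_const H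
  have hd : HasStrictFDerivAt (𝒯.quadMap T) ((ContinuousLinearMap.fst ℝ ℝ ℝ).smulRight A +
      (ContinuousLinearMap.snd ℝ ℝ ℝ).smulRight B +
      (p.1 • ContinuousLinearMap.snd ℝ ℝ ℝ +
        p.2 • ContinuousLinearMap.fst ℝ ℝ ℝ).smulRight H) p := by
    rw [hF]
    exact ((hA'.const_add C).add hB').add hH'
  have hJ := (𝒯.cross_quadDeriv_pos T (hUs hp)).ne'
  rw [← hd.map_nhds_eq_of_surj]
  · exact Filter.image_mem_map (hU.mem_nhds hp)
  rw [LinearMap.range_eq_top]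
  intro y
  set a := 𝒯.quadDeriv₁ T p with ha
  set b := 𝒯.quadDeriv₂ T p with hb
  have ha' : a = A + p.2 • H := by
    apply Plane.ext <;> simp [ha, hA, hH, quadDeriv₁] <;> ring
  have hb' : b = B + p.1 • H := by
    apply Plane.ext <;> simp [hb, hB, hH, quadDeriv₂] <;> ring
  refine ⟨(cross y b / cross a b, cross a y / cross a b), ?_⟩
  have hy : y = (cross y b / cross a b) • a + (cross a y / cross a b) • b := by
    apply Plane.ext <;> simp only [PiLp.add_apply, PiLp.smul_apply, smul_eq_mul] <;>
      field_simp <;> simp only [cross] <;> ring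
  generalize cross y b / cross a b = s at hy ⊢
  generalize cross a y / cross a b = t at hy ⊢
  rw [hy, ha', hb']
  simp
  module

theorem quadGaussValue_eq_zero (hΩ : IsPolygonalDomain Ω) {ε : Plane → Voigt}
    (h : 𝒯.quadSmooth ε =ᵐ[volume.restrict Ω] 0) (T : Fin 𝒯.numElements) (i : Fin 4) :
    𝒯.quadGaussValue ε T i = 0 := by
  set U : Set (ℝ × ℝ) := Set.Ioo (-1 : ℝ) 1 ×ˢ Set.Ioo (-1 : ℝ) 1 with hU
  have hUs : U ⊆ refSquare := Set.prod_mono Set.Ioo_subset_Icc_self Set.Ioo_subset_Icc_self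
  have h3 : 1 < √(3 : ℝ) := by
    rw [Real.lt_sqrt] <;> norm_num
  have hlt : 1 / √(3 : ℝ) < 1 := by
    rw [div_lt_one] <;> linarith
  have hs3 : 0 < √(3 : ℝ) := by positivity
  have hp : ((refNode i).1 / √3, (refNode i).2 / √3) ∈ U := by
    have h1 : |(refNode i).1| = 1 := by fin_cases i <;> simp [refNode]
    have h2 : |(refNode i).2| = 1 := by fin_cases i <;> simp [refNode]
    refine ⟨abs_lt.1 ?_, abs_lt.1 ?_⟩ <;> simp only [abs_div, h1, h2, abs_of_pos hs3, hlt]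
  have := 𝒯.eqOn_zero_of_ae hΩ
    (F := fun T y => refInterpolate (𝒯.quadGaussValue ε T) (𝒯.naturalCoord T y)) h T
    (𝒯.isOpen_image_quadMap T (isOpen_Ioo.prod isOpen_Ioo) hUs)
    (by
      rintro _ ⟨p, hp, rfl⟩
      exact 𝒯.quadMap_mem_cell T (hUs hp))
    ((continuous_refInterpolate _).comp_continuousOn
      ((𝒯.continuousOn_naturalCoord T).mono (Set.image_mono hUs))) ⟨_, hp, rfl⟩
  simpa [𝒯.naturalCoord_quadMap T (hUs hp), refInterpolate_gaussPoint] using this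

end Mesh

/-! ### Algebra of a single quadrilateral -/

theorem sum_four_cyclic {M : Type*} [AddCommMonoid M] (f : Fin 4 → M) (i : Fin 4) :
    ∑ k, f k = f i + f (i + 1) + f (i + 2) + f (i + 3) := by
  rw [← Equiv.sum_comp (Equiv.addLeft i) f]
  simp [Fin.sum_univ_four]

theorem forall_four_cyclic {P : Fin 4 → Prop} (i : Fin 4) (h0 : P i) (h1 : P (i + 1))
    (h2 : P (i + 2)) (h3 : P (i + 3)) (k : Fin 4) : P k := by
  have : ∀ i k : Fin 4, k = i ∨ k = i + 1 ∨ k = i + 2 ∨ k = i + 3 := by decide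
  rcases this i k with rfl | rfl | rfl | rfl <;> assumption

/-- If the edges of a quadrilateral are not elongated and one of its edges and its center undergo
a rigid motion, so does the whole quadrilateral. -/
theorem eq_rigid_of_edge {x u : Fin 4 → Plane} {ω : ℝ} {d : Plane} {i : Fin 4}
    (hx : ∀ i, 0 < cross (x (i + 1) - x i) (x (i + 2) - x (i + 1)))
    (hel : ∀ i, (u (i + 1) 0 - u i 0) * (x (i + 1) 0 - x i 0) +
      (u (i + 1) 1 - u i 1) * (x (i + 1) 1 - x i 1) = 0)
    (h0 : u i = rigid ω d (x i)) (h1 : u (i + 1) = rigid ω d (x (i + 1)))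
    (hc : (1 / 4 : ℝ) • ∑ k, u k = rigid ω d ((1 / 4 : ℝ) • ∑ k, x k)) (k : Fin 4) :
    u k = rigid ω d (x k) := by
  rw [sum_four_cyclic u i, sum_four_cyclic x i] at hc
  have a0 := congrArg (fun x : Plane => x 0) h0
  have a1 := congrArg (fun x : Plane => x 1) h0
  have b0 := congrArg (fun x : Plane => x 0) h1
  have b1 := congrArg (fun x : Plane => x 1) h1
  have c0 := congrArg (fun x : Plane => x 0) hc
  have c1 := congrArg (fun x : Plane => x 1) hc
  have e1 : i + 1 + 1 = i + 2 := add_assoc i 1 1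
  have e2 : i + 2 + 1 = i + 3 := add_assoc i 2 1
  have e3 : i + 1 + 2 = i + 3 := add_assoc i 1 2
  have hJ := (hx (i + 1)).ne'
  have f1 := hel (i + 1)
  have f2 := hel (i + 2)
  rw [e1, e3] at hJ
  rw [e1] at f1
  rw [e2] at f2
  simp only [rigid_zero, rigid_one, PiLp.smul_apply, PiLp.add_apply, smul_eq_mul] at *
  simp only [cross, PiLp.sub_apply] at hJ
  -- Let `e` be the deviation from the rigid motion at the node `i + 2`. The center condition makes
  -- it `-e` at the node `i + 3`. The unelongated edges `i + 1` and `i + 2` are both orthogonal to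
  -- `e`, and they are not parallel.
  have g1 : (u (i + 2) 0 - (d 0 - ω * x (i + 2) 1)) * (x (i + 2) 0 - x (i + 1) 0) +
      (u (i + 2) 1 - (d 1 + ω * x (i + 2) 0)) * (x (i + 2) 1 - x (i + 1) 1) = 0 := by
    linear_combination f1 + (x (i + 2) 0 - x (i + 1) 0) * b0 + (x (i + 2) 1 - x (i + 1) 1) * b1
  have g2 : (u (i + 2) 0 - (d 0 - ω * x (i + 2) 1)) * (x (i + 3) 0 - x (i + 2) 0) +
      (u (i + 2) 1 - (d 1 + ω * x (i + 2) 0)) * (x (i + 3) 1 - x (i + 2) 1) = 0 := by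
    linear_combination -(1 / 2) * f2 +
      (x (i + 3) 0 - x (i + 2) 0) / 2 * (4 * c0 - a0 - b0) +
      (x (i + 3) 1 - x (i + 2) 1) / 2 * (4 * c1 - a1 - b1)
  have k0 : u (i + 2) 0 = d 0 - ω * x (i + 2) 1 := by
    refine sub_eq_zero.1 (mul_left_cancel₀ hJ ?_)
    linear_combination (x (i + 3) 1 - x (i + 2) 1) * g1 - (x (i + 2) 1 - x (i + 1) 1) * g2
  have k1 : u (i + 2) 1 = d 1 + ω * x (i + 2) 0 := by
    refine sub_eq_zero.1 (mul_left_cancel₀ hJ ?_)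
    linear_combination -(x (i + 3) 0 - x (i + 2) 0) * g1 + (x (i + 2) 0 - x (i + 1) 0) * g2
  refine forall_four_cyclic (P := fun k => u k = rigid ω d (x k)) i ?_ ?_ ?_ ?_ k
  · exact h0
  · exact h1
  · exact Plane.ext (by rw [rigid_zero, k0]) (by rw [rigid_one, k1])
  · apply Plane.ext
    · rw [rigid_zero]
      linear_combination 4 * c0 - a0 - b0 - k0
    · rw [rigid_one]
      linear_combination 4 * c1 - a1 - b1 - k1

/-- The alternating sum of the integrals of the strain over the four subtriangles, each spanned
by an edge and the mean of the nodes, vanishes. -/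
theorem alternating_sum_eq_zero {x u : Fin 4 → Plane} {L : Fin 4 → Plane →ₗ[ℝ] Plane}
    {c w : Plane} (hc : c = (1 / 4 : ℝ) • ∑ i, x i) (hw : w = (1 / 4 : ℝ) • ∑ i, u i)
    (h0 : ∀ i, L i (x i - c) = u i - w) (h1 : ∀ i, L i (x (i + 1) - c) = u (i + 1) - w) :
    cross (x 0 - c) (x 1 - c) • linStrain (L 0) - cross (x 1 - c) (x 2 - c) • linStrain (L 1) +
      cross (x 2 - c) (x 3 - c) • linStrain (L 2) -
      cross (x 3 - c) (x 0 - c) • linStrain (L 3) = 0 := by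
  have a0 := h0 0
  have a1 := h0 1
  have a2 := h0 2
  have a3 := h0 3
  have b0 := h1 0
  have b1 := h1 1
  have b2 := h1 2
  have b3 := h1 3
  simp only [zero_add, Fin.isValue, Fin.reduceAdd] at b0 b1 b2 b3
  -- Relative to the center, each term is bilinear in positions and displacements. Regrouping the
  -- alternating sum pairs each displacement with the sum of the two neighboring positions; it
  -- cancels because positions and displacements both sum to zero.
  simp only [cross_smul_linStrain, a0, a1, a2, a3, b0, b1, b2, b3]
  subst hc hw
  ext k
  fin_cases k <;> simp [Fin.sum_univ_four] <;> ring

/-- Two numbers with a vanishing positive combination have opposite signs. -/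
theorem div_abs_eq_neg {a b x y : ℝ} (ha : 0 < a) (hb : 0 < b) (h : a * x + b * y = 0) :
    y / |y| = -(x / |x|) := by
  obtain rfl : y = -(a / b) * x := by
    field_simp
    linarith
  rw [abs_mul, abs_neg, abs_of_pos (div_pos ha hb), neg_mul, neg_div,
    mul_div_mul_left _ _ (div_pos ha hb).ne']

/-- Averages over the pairs of an involution whose signs alternate in groups vanish. -/
theorem average_eq_zero {N : ℕ} {ν : Fin N × Fin 4 → Fin N × Fin 4}
    (hν : Function.Involutive ν) {a E d : Fin N × Fin 4 → ℝ} (ha : ∀ x, 0 < a x)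
    (hd : ∀ x, (a x + a (ν x)) * d x = E x + E (ν x))
    (hsum : ∀ T, E (T, 0) - E (T, 1) + E (T, 2) - E (T, 3) = 0)
    (hg : ∀ T i, a (T, i) * d (T, i) + a (T, i + 1) * d (T, i + 1) = 0) (x : Fin N × Fin 4) :
    d x = 0 := by
  have hdν : ∀ x, d (ν x) = d x := by
    intro x
    have h := hd (ν x)
    rw [hν x, add_comm, add_comm (E _), ← hd x] at h
    exact mul_left_cancel₀ (add_pos (ha _) (ha _)).ne' h
  -- The sign of `d`, which is zero where `d` is zero since `0 / 0 = 0`.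
  set σ : Fin N × Fin 4 → ℝ := fun x => d x / |d x| with hσ
  have hσσ : ∀ T i, σ (T, i + 1) = -σ (T, i) := fun T i =>
    div_abs_eq_neg (ha _) (ha _) (hg T i)
  have h1 : ∑ x, σ x * E x = 0 := by
    rw [Fintype.sum_prod_type]
    refine Finset.sum_eq_zero fun T _ => ?_
    have s1 := hσσ T 0
    have s2 := hσσ T 1
    have s3 := hσσ T 2
    simp only [zero_add, Fin.isValue, Fin.reduceAdd] at s1 s2 s3
    rw [Fin.sum_univ_four, s3, s2, s1]
    linear_combination σ (T, 0) * hsum T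
  -- Since `d`, and with it `σ`, is invariant under `ν`, this is the sum in `h1` reindexed.
  have h2 : ∑ x, σ x * E (ν x) = 0 := by
    rw [← h1, ← Equiv.sum_comp hν.toPerm fun x => σ x * E x]
    refine Finset.sum_congr rfl fun x _ => ?_
    simp [hσ, hdν]
  have h3 : ∑ x, (a x + a (ν x)) * |d x| = 0 := by
    rw [← add_zero (0 : ℝ)]
    nth_rewrite 1 [← h1]
    rw [← h2, ← Finset.sum_add_distrib]
    refine Finset.sum_congr rfl fun x _ => ?_
    rw [← mul_add, ← hd x, hσ]
    by_cases hx : d x = 0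
    · simp [hx]
    · have : |d x| ≠ 0 := abs_ne_zero.2 hx
      field_simp
      rw [sq_abs]
  rw [Finset.sum_eq_zero_iff_of_nonneg fun x _ =>
    mul_nonneg (add_pos (ha _) (ha _)).le (abs_nonneg _)] at h3
  exact abs_eq_zero.1 ((mul_eq_zero.1 (h3 x (Finset.mem_univ _))).resolve_left
    (add_pos (ha _) (ha _)).ne')

namespace Mesh

/-! ### The quadrilateral element -/

variable {Ω ΓD : Set Plane} {𝒯 : Mesh 4 Ω}

theorem node_mem_subTriangle (𝒯 : Mesh 4 Ω) (T : Fin 𝒯.numElements) (i : Fin 4) :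
    𝒯.node T i ∈ 𝒯.subTriangle T i :=
  subset_convexHull ℝ _ (by simp)

theorem node_succ_mem_subTriangle (𝒯 : Mesh 4 Ω) (T : Fin 𝒯.numElements) (i : Fin 4) :
    𝒯.node T (i + 1) ∈ 𝒯.subTriangle T i :=
  subset_convexHull ℝ _ (by simp)

theorem center_mem_subTriangle (𝒯 : Mesh 4 Ω) (T : Fin 𝒯.numElements) (i : Fin 4) :
    𝒯.center T ∈ 𝒯.subTriangle T i :=
  subset_convexHull ℝ _ (by simp)

theorem convex_subTriangle (𝒯 : Mesh 4 Ω) (T : Fin 𝒯.numElements) (i : Fin 4) :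
    Convex ℝ (𝒯.subTriangle T i) :=
  convex_convexHull ℝ _

theorem cross_center_pos (𝒯 : Mesh 4 Ω) (T : Fin 𝒯.numElements) (i : Fin 4) :
    0 < cross (𝒯.node T i - 𝒯.center T) (𝒯.node T (i + 1) - 𝒯.center T) := by
  have h := 𝒯.isConvexPolygon_four T
  have hc : cross (𝒯.node T i - 𝒯.center T) (𝒯.node T (i + 1) - 𝒯.center T) =
      cross (𝒯.node T (i + 1) - 𝒯.node T i) (∑ k, (1 / 4 : ℝ) • 𝒯.node T k - 𝒯.node T i) := by
    rw [← Finset.smul_sum, ← 𝒯.center_eq]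
    simp only [cross, PiLp.sub_apply]
    ring
  have hne : ∀ i : Fin 4, i + 2 ≠ i ∧ i + 2 ≠ i + 1 := by decide
  rw [hc, cross_sub_sum _ (by norm_num)]
  refine Finset.sum_pos' (fun k _ => mul_nonneg (by norm_num) (h.left_nonneg i k))
    ⟨i + 2, Finset.mem_univ _, mul_pos (by norm_num) (h.left i _ (hne i).1 (hne i).2)⟩

/-- The vectors from the center to the nodes sum to zero, hence so do the `f i`. Going around, some
`f i ≥ 0` is followed by `f (i + 1) ≤ 0`, which places `y` in the sector of the edge `i`. -/
theorem cell_subset_subTriangle (𝒯 : Mesh 4 Ω) {T : Fin 𝒯.numElements} {y : Plane}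
    (hy : y ∈ 𝒯.cell T) : ∃ i, y ∈ 𝒯.subTriangle T i := by
  set f : Fin 4 → ℝ := fun i => cross (𝒯.node T i - 𝒯.center T) (y - 𝒯.center T) with hf
  have hsum : ∑ i, f i = 0 := by
    simp only [hf, center_eq, cross, Fin.sum_univ_four, PiLp.sub_apply, PiLp.smul_apply,
      PiLp.add_apply, smul_eq_mul]
    ring
  obtain ⟨i, hi, hi'⟩ : ∃ i, 0 ≤ f i ∧ f (i + 1) ≤ 0 := by
    by_contra! hno
    have hex : ∃ i, 0 ≤ f i := by
      by_contra! hneg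
      exact (Finset.sum_neg (fun i _ => hneg i) Finset.univ_nonempty).ne hsum
    obtain ⟨i, hi⟩ := hex
    have h1 := hno i hi
    have h2 := hno _ h1.le
    have h3 := hno _ h2.le
    rw [sum_four_cyclic f i] at hsum
    rw [show i + 1 + 1 = i + 2 from add_assoc i 1 1] at h2 h3
    rw [show i + 2 + 1 = i + 3 from add_assoc i 2 1] at h3
    linarith
  refine ⟨i, mem_convexHull_triangle ?_ ((𝒯.isConvexPolygon_four T).cross_nonneg hy i) ?_ ?_⟩
  · have := 𝒯.cross_center_pos T i
    simp only [cross, PiLp.sub_apply] at this ⊢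
    linarith
  · simp only [hf, cross, PiLp.sub_apply] at hi' ⊢
    linarith
  · simp only [hf, cross, PiLp.sub_apply] at hi ⊢
    linarith

theorem quad_eqOn_closure (𝒯 : Mesh 4 Ω) {u v : Plane → Plane}
    (hu : ∀ T i, IsAffineOn u (𝒯.subTriangle T i))
    (huc : ∀ T, u (𝒯.center T) = (1 / 4 : ℝ) • ∑ i, u (𝒯.node T i))
    (hv : ∀ T i, IsAffineOn v (𝒯.subTriangle T i))
    (hvc : ∀ T, v (𝒯.center T) = (1 / 4 : ℝ) • ∑ i, v (𝒯.node T i))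
    (h : ∀ T k, u (𝒯.node T k) = v (𝒯.node T k)) : Set.EqOn u v (closure Ω) := by
  intro x hx
  obtain ⟨T, hT⟩ := 𝒯.exists_mem_cell hx
  obtain ⟨i, hi⟩ := 𝒯.cell_subset_subTriangle hT
  obtain ⟨g, hg⟩ := hu T i
  obtain ⟨k, hk⟩ := hv T i
  rw [hg hi, hk hi]
  refine eqOn_convexHull ?_ hi
  rintro _ (rfl | rfl | rfl)
  · rw [← hg (𝒯.node_mem_subTriangle T i), ← hk (𝒯.node_mem_subTriangle T i), h]
  · rw [← hg (𝒯.node_succ_mem_subTriangle T i), ← hk (𝒯.node_succ_mem_subTriangle T i), h]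
  · rw [← hg (𝒯.center_mem_subTriangle T i), ← hk (𝒯.center_mem_subTriangle T i), huc, hvc]
    simp only [h]

theorem finiteDimensional_quadSpace (𝒯 : Mesh 4 Ω) (ΓD : Set Plane) :
    FiniteDimensional ℝ (𝒯.quadSpace ΓD) := by
  refine 𝒯.finiteDimensional_of_nodes _ fun u hu h0 => ?_
  funext x
  by_cases hx : x ∈ closure Ω
  · exact 𝒯.quad_eqOn_closure (v := 0) hu.2.1 hu.2.2 (fun T _ => IsAffineOn.zero _)
      (fun T => by simp) (fun T k => h0 T k) hx
  · exact hu.1.2.1 x hx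

theorem rigid_center (𝒯 : Mesh 4 Ω) (ω : ℝ) (d : Plane) (T : Fin 𝒯.numElements) :
    rigid ω d (𝒯.center T) = (1 / 4 : ℝ) • ∑ i, rigid ω d (𝒯.node T i) := by
  rw [center_eq]
  apply Plane.ext <;> simp [Fin.sum_univ_four, rigid_zero, rigid_one] <;> ring

/-- The area of the triangle spanned by the origin and the two unit vectors. -/
def unitArea : ℝ := volume.real
  (convexHull ℝ {0, EuclideanSpace.single 0 1, EuclideanSpace.single 1 1} : Set Plane)

theorem unitArea_pos : 0 < unitArea := by
  have h : IsConvexPolygon (![0, EuclideanSpace.single 0 1, EuclideanSpace.single 1 1] :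
      Fin 3 → Plane) := SSE.isConvexPolygon_three fun i => by
    fin_cases i <;> simp [cross]
  have hr : Set.range (![0, EuclideanSpace.single 0 1, EuclideanSpace.single 1 1] :
      Fin 3 → Plane) = {0, EuclideanSpace.single 0 1, EuclideanSpace.single 1 1} := by
    ext x
    simp
    tauto
  obtain ⟨δ, hδ⟩ := (h.eventually_mem_interior 0).exists
  rw [hr] at hδ
  exact volume_real_pos ((Set.toFinite _).isCompact_convexHull ℝ) ⟨_, hδ⟩

theorem volume_subTriangle (𝒯 : Mesh 4 Ω) (T : Fin 𝒯.numElements) (i : Fin 4) :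
    volume.real (𝒯.subTriangle T i) =
      unitArea * cross (𝒯.node T i - 𝒯.center T) (𝒯.node T (i + 1) - 𝒯.center T) := by
  have h := 𝒯.cross_center_pos T i
  have hc : cross (𝒯.node T (i + 1) - 𝒯.node T i) (𝒯.center T - 𝒯.node T i) =
      cross (𝒯.node T i - 𝒯.center T) (𝒯.node T (i + 1) - 𝒯.center T) := by
    simp only [cross, PiLp.sub_apply]
    ring
  rw [subTriangle, volume_triangle, hc, abs_of_pos h, mul_comm]
  rfl

theorem volume_subTriangle_pos (𝒯 : Mesh 4 Ω) (T : Fin 𝒯.numElements) (i : Fin 4) :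
    0 < volume.real (𝒯.subTriangle T i) := by
  rw [volume_subTriangle]
  exact mul_pos unitArea_pos (𝒯.cross_center_pos T i)

/-- Both `g` and the rigid motion compute the strain integral over a subtriangle of positive area,
so their strains agree. -/
theorem linStrain_eq_zero_of_rigid (𝒯 : Mesh 4 Ω) {u : Plane → Plane} {T : Fin 𝒯.numElements}
    (huc : u (𝒯.center T) = (1 / 4 : ℝ) • ∑ i, u (𝒯.node T i)) {ω : ℝ} {d : Plane}
    (h : ∀ k, u (𝒯.node T k) = rigid ω d (𝒯.node T k)) {i : Fin 4} {g : Plane →ᵃ[ℝ] Plane}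
    (hg : Set.EqOn u g (𝒯.subTriangle T i)) : linStrain g.linear = 0 := by
  have heq : Set.EqOn g (rigid ω d) (𝒯.subTriangle T i) := by
    refine eqOn_convexHull ?_
    rintro _ (rfl | rfl | rfl)
    · rw [← hg (𝒯.node_mem_subTriangle T i), h]
    · rw [← hg (𝒯.node_succ_mem_subTriangle T i), h]
    · rw [← hg (𝒯.center_mem_subTriangle T i), huc, rigid_center]
      simp only [h]
  have h1 := setIntegral_strain (𝒯.convex_subTriangle T i) hg
  rw [setIntegral_strain (𝒯.convex_subTriangle T i) (hg.trans heq)] at h1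
  have h0 : linStrain (rigid ω d).linear = 0 := by
    ext k
    fin_cases k <;> simp [linStrain, rigid, Matrix.toLpLin_apply]
  rw [h0, smul_zero] at h1
  exact (smul_eq_zero.1 h1.symm).resolve_left (𝒯.volume_subTriangle_pos T i).ne'

theorem quadIntermediate_eq_zero {u : Plane → Plane}
    {g : Fin 𝒯.numElements → Fin 4 → Plane →ᵃ[ℝ] Plane}
    (hg : ∀ T i, Set.EqOn u (g T i) (𝒯.subTriangle T i))
    (huc : ∀ T, u (𝒯.center T) = (1 / 4 : ℝ) • ∑ i, u (𝒯.node T i))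
    (hG : ∀ T i, 𝒯.quadGaussValue (strain u) T i = 0) (T : Fin 𝒯.numElements) (i : Fin 4) :
    𝒯.quadIntermediate (strain u) T i = 0 := by
  have hvol := 𝒯.volume_subTriangle_pos
  ext k
  refine average_eq_zero (ν := fun x => 𝒯.neighbor x.1 x.2)
    (a := fun x => volume.real (𝒯.subTriangle x.1 x.2))
    (E := fun x => (∫ y in 𝒯.subTriangle x.1 x.2, strain u y) k)
    (d := fun x => 𝒯.quadIntermediate (strain u) x.1 x.2 k)
    (fun x => neighbor_neighbor 𝒯.isConvexPolygon_four x.1 x.2) (fun x => hvol _ _) ?_ ?_ ?_ (T, i)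
  · intro x
    have := (add_pos (hvol x.1 x.2) (hvol (𝒯.neighbor x.1 x.2).1 (𝒯.neighbor x.1 x.2).2)).ne'
    rw [quadIntermediate, neighborSubTriangle, Pi.smul_apply, Pi.add_apply, smul_eq_mul,
      mul_inv_cancel_left₀ this]
  · intro T
    have h := alternating_sum_eq_zero (x := 𝒯.node T) (u := fun i => u (𝒯.node T i))
      (L := fun i => (g T i).linear) (𝒯.center_eq T) (huc T)
      (fun i => by
        rw [hg T i (𝒯.node_mem_subTriangle T i), hg T i (𝒯.center_mem_subTriangle T i)]
        exact AffineMap.linearMap_vsub _ _ _)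
      (fun i => by
        rw [hg T i (𝒯.node_succ_mem_subTriangle T i), hg T i (𝒯.center_mem_subTriangle T i)]
        exact AffineMap.linearMap_vsub _ _ _)
    have h' := congrFun h k
    simp only [setIntegral_strain (𝒯.convex_subTriangle _ _) (hg _ _), volume_subTriangle,
      Pi.add_apply, Pi.sub_apply, Pi.smul_apply, smul_eq_mul, Pi.zero_apply, zero_add,
      Fin.isValue, Fin.reduceAdd] at h' ⊢
    linear_combination unitArea * h'
  -- The Gauss value at the node `i + 1` combines the edges `i` and `i + 1`.
  · intro T i
    have h := (smul_eq_zero.1 (hG T (i + 1))).resolve_left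
      (inv_ne_zero (add_pos (hvol _ _) (hvol _ _)).ne')
    rw [add_sub_cancel_right] at h
    exact congrFun h k

/-- Four unelongated edges leave a quadrilateral free to deform, so vanishing elongations alone do
not suffice: rigidity has to start at the boundary and spread. -/
theorem quadSpace_eq_zero (hΩ : IsPolygonalDomain Ω) (hΓD : ΓD ⊆ frontier Ω)
    (hm : MeasurableSet ΓD) (hΓD_pos : 0 < (Measure.hausdorffMeasure 1 : Measure Plane) ΓD)
    {u : Plane → Plane} (hu : u ∈ 𝒯.quadSpace ΓD)
    (h : 𝒯.quadSmooth (strain u) =ᵐ[volume.restrict Ω] 0) : u = 0 := by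
  have h𝒯 := 𝒯.isConvexPolygon_four
  have hvol := 𝒯.volume_subTriangle_pos
  choose g hg using hu.2.1
  have huc := hu.2.2
  have hE : ∀ T i, volume.real (𝒯.subTriangle T i) • linStrain (g T i).linear +
      volume.real (𝒯.neighborSubTriangle T i) •
        linStrain (g (𝒯.neighbor T i).1 (𝒯.neighbor T i).2).linear = 0 := by
    intro T i
    have hI := quadIntermediate_eq_zero hg huc (quadGaussValue_eq_zero hΩ h) T i
    rwa [quadIntermediate, neighborSubTriangle,
      setIntegral_strain (𝒯.convex_subTriangle _ _) (hg _ _),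
      setIntegral_strain (𝒯.convex_subTriangle _ _) (hg _ _), smul_eq_zero,
      or_iff_right (inv_ne_zero (add_pos (hvol _ _) (hvol _ _)).ne')] at hI
  have hel : ∀ T i, elongation (linStrain (g T i).linear)
      (𝒯.node T (i + 1) - 𝒯.node T i) = 0 := by
    intro T i
    have he := congrArg (fun ε => elongation ε (𝒯.node T (i + 1) - 𝒯.node T i)) (hE T i)
    simp only [elongation_add, elongation_smul] at he
    have h0 : elongation 0 (𝒯.node T (i + 1) - 𝒯.node T i) = 0 := by simp [elongation]
    have heq : elongation (linStrain (g (𝒯.neighbor T i).1 (𝒯.neighbor T i).2).linear)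
        (𝒯.node T (i + 1) - 𝒯.node T i) =
        elongation (linStrain (g T i).linear) (𝒯.node T (i + 1) - 𝒯.node T i) := by
      rcases 𝒯.neighbor_cases T i with hn | hn
      · rw [hn]
      · obtain ⟨e0, e1⟩ := hn.node_eq h𝒯
        rw [elongation_of_eqOn (hg T i) (𝒯.node_mem_subTriangle _ _)
          (𝒯.node_succ_mem_subTriangle _ _), elongation_of_eqOn (hg _ _)
          (e1 ▸ 𝒯.node_succ_mem_subTriangle _ _) (e0 ▸ 𝒯.node_mem_subTriangle _ _)]
    rw [heq, h0, ← add_mul] at he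
    exact (mul_eq_zero.1 he).resolve_left (add_pos (hvol _ _) (hvol _ _)).ne'
  have hrigid : ∀ T i, linStrain (g T i).linear = 0 →
      ∃ ω d, ∀ k, u (𝒯.node T k) = rigid ω d (𝒯.node T k) := by
    intro T i hi
    obtain ⟨ω, d, hgr⟩ := exists_rigid_of_linStrain_eq_zero hi
    refine ⟨ω, d, eq_rigid_of_edge (x := 𝒯.node T) (u := fun k => u (𝒯.node T k)) (i := i)
      (𝒯.counterclockwise T) (fun j => ?_) ?_ ?_ ?_⟩
    · rw [← elongation_of_eqOn (hg T j) (𝒯.node_mem_subTriangle _ _)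
        (𝒯.node_succ_mem_subTriangle _ _), hel]
    · rw [hg T i (𝒯.node_mem_subTriangle _ _), hgr]
    · rw [hg T i (𝒯.node_succ_mem_subTriangle _ _), hgr]
    · rw [← huc, ← center_eq, hg T i (𝒯.center_mem_subTriangle _ _), hgr]
  -- At a boundary edge the mean is the strain of the subtriangle itself, so that strain vanishes
  -- and its element is rigid. Across a common edge the two strain integrals are opposite, so the
  -- adjacent subtriangle is strain-free too.
  have hzero : ∀ T, ∀ i, linStrain (g T i).linear = 0 := by
    have hall : ∀ T i, linStrain (g T i).linear = 0 → ∀ j, linStrain (g T j).linear = 0 := by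
      intro T i hi j
      obtain ⟨ω, d, hr⟩ := hrigid T i hi
      exact 𝒯.linStrain_eq_zero_of_rigid (huc T) hr (hg T j)
    refine edge_induction h𝒯 hΩ _ ?_ ?_
    · intro T i T' j hadj hT
      refine hall T' j ?_
      have hE' := hE T' j
      rw [neighbor_eq h𝒯 hadj.symm, hT i, smul_zero, add_zero] at hE'
      exact (smul_eq_zero.1 hE').resolve_left (hvol _ _).ne'
    · obtain ⟨T, i, hno⟩ := exists_boundary_edge h𝒯 hΩ
        ((infinite_of_hausdorffMeasure_pos hΓD_pos).mono hΓD)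
      refine ⟨T, hall T i ?_⟩
      have hE' := hE T i
      rw [neighborSubTriangle, neighbor_eq_self hno, ← add_smul] at hE'
      exact (smul_eq_zero.1 hE').resolve_left (add_pos (hvol _ _) (hvol _ _)).ne'
  obtain ⟨ω, d, hωd⟩ := exists_rigid h𝒯 hΩ (u := u) fun T => hrigid T 0 (hzero T 0)
  exact eq_zero_of_eqOn_rigid hΓD hΓD_pos hm hu.1 (𝒯.quad_eqOn_closure hu.2.1 hu.2.2
    (fun T i => ⟨rigid ω d, fun _ _ => rfl⟩) (𝒯.rigid_center ω d) hωd)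

theorem quadSmooth_add {u v : Plane → Plane} (hu : u ∈ 𝒯.quadSpace ΓD)
    (hv : v ∈ 𝒯.quadSpace ΓD) :
    𝒯.quadSmooth (strain (u + v)) = 𝒯.quadSmooth (strain u) + 𝒯.quadSmooth (strain v) := by
  have hI : ∀ T i, 𝒯.quadIntermediate (strain (u + v)) T i =
      𝒯.quadIntermediate (strain u) T i + 𝒯.quadIntermediate (strain v) T i := by
    intro T i
    simp only [quadIntermediate, neighborSubTriangle,
      setIntegral_strain_add (𝒯.convex_subTriangle _ _) (hu.2.1 _ _) (hv.2.1 _ _)]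
    module
  have hG : ∀ T i, 𝒯.quadGaussValue (strain (u + v)) T i =
      𝒯.quadGaussValue (strain u) T i + 𝒯.quadGaussValue (strain v) T i := by
    intro T i
    simp only [quadGaussValue, hI]
    module
  funext x
  simp only [quadSmooth, Pi.add_apply, ← Finset.sum_add_distrib]
  refine Finset.sum_congr rfl fun T _ => ?_
  rw [← Pi.add_apply, ← Set.indicator_add']
  congr 1
  funext y
  simp only [refInterpolate, hG, smul_add, Finset.sum_add_distrib, Pi.add_apply]

theorem quadSmooth_smul (c : ℝ) {u : Plane → Plane} (hu : u ∈ 𝒯.quadSpace ΓD) :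
    𝒯.quadSmooth (strain (c • u)) = c • 𝒯.quadSmooth (strain u) := by
  have hI : ∀ T i, 𝒯.quadIntermediate (strain (c • u)) T i =
      c • 𝒯.quadIntermediate (strain u) T i := by
    intro T i
    simp only [quadIntermediate, neighborSubTriangle,
      setIntegral_strain_smul (𝒯.convex_subTriangle _ _) c (hu.2.1 _ _)]
    module
  have hG : ∀ T i, 𝒯.quadGaussValue (strain (c • u)) T i =
      c • 𝒯.quadGaussValue (strain u) T i := by
    intro T i
    simp only [quadGaussValue, hI]
    module
  funext x
  simp only [quadSmooth, Pi.smul_apply, Finset.smul_sum, ← Set.indicator_const_smul_apply]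
  refine Finset.sum_congr rfl fun T _ => ?_
  congr 1
  funext y
  simp only [refInterpolate, hG, Finset.smul_sum, smul_comm c]

theorem existsUnique_quad (𝒯 : Mesh 4 Ω) (hΩ : IsPolygonalDomain Ω) (hΓD : ΓD ⊆ frontier Ω)
    (hm : MeasurableSet ΓD) (hΓD_pos : 0 < (Measure.hausdorffMeasure 1 : Measure Plane) ΓD)
    {D : Matrix (Fin 3) (Fin 3) ℝ} (hD : D.PosDef) {b t : Plane → Plane}
    (hb : IntegrableOn b Ω volume)
    (ht : IntegrableOn t (frontier Ω \ ΓD) (Measure.hausdorffMeasure 1)) :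
    ∃! u : Plane → Plane, u ∈ 𝒯.quadSpace ΓD ∧
      ∀ v ∈ 𝒯.quadSpace ΓD, 𝒯.quadForm D u v = load Ω ΓD b t v := by
  have := 𝒯.finiteDimensional_quadSpace ΓD
  exact existsUnique_variational hΩ.isBounded.measure_lt_top hD (𝒯.quadSpace ΓD)
    (fun u => 𝒯.quadSmooth (strain u))
    (fun u hu v hv => quadSmooth_add hu hv) (fun c u hu => quadSmooth_smul c hu)
    (fun u _ => 𝒯.measurable_sum_indicator fun T =>
      (continuous_refInterpolate _).measurable.comp (𝒯.measurable_naturalCoord T))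
    (fun u _ => 𝒯.bounded_sum_indicator fun T => 𝒯.bounded_refInterpolate T _)
    (fun u hu => quadSpace_eq_zero hΩ hΓD hm hΓD_pos hu) (load Ω ΓD b t)
    (fun u hu v hv => load_add hΩ hm hb ht hu.1.1 hv.1.1) (fun c u _ => load_smul Ω ΓD b t c u)

end Mesh

end SSE

end

theorem mainTheorem8
    (Ω : Set SSE.Plane) (hΩ : SSE.IsPolygonalDomain Ω)
    (ΓD : Set SSE.Plane) (hΓD : ΓD ⊆ frontier Ω) (hΓD_meas : MeasurableSet ΓD)
    (hΓD_pos : 0 < (Measure.hausdorffMeasure 1 : Measure SSE.Plane) ΓD)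
    (D : Matrix (Fin 3) (Fin 3) ℝ) (hD : D.PosDef)
    (b t : SSE.Plane → SSE.Plane) (hb : IntegrableOn b Ω volume)
    (ht : IntegrableOn t (frontier Ω \ ΓD) (Measure.hausdorffMeasure 1)) :
    (∀ 𝒯 : SSE.Mesh 3 Ω, ∃! u : SSE.Plane → SSE.Plane, u ∈ 𝒯.triSpace ΓD ∧
      ∀ v ∈ 𝒯.triSpace ΓD, 𝒯.triForm D u v = SSE.load Ω ΓD b t v) ∧
    (∀ 𝒯 : SSE.Mesh 4 Ω, ∃! u : SSE.Plane → SSE.Plane, u ∈ 𝒯.quadSpace ΓD ∧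
      ∀ v ∈ 𝒯.quadSpace ΓD, 𝒯.quadForm D u v = SSE.load Ω ΓD b t v) :=
  ⟨fun 𝒯 => 𝒯.existsUnique_tri hΩ hΓD hΓD_meas hΓD_pos hD hb ht,
    fun 𝒯 => 𝒯.existsUnique_quad hΩ hΓD hΓD_meas hΓD_pos hD hb ht⟩
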